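/- Let $n\ge 0$, $[-n;n]=\{-n,\dots,-1,1,\dots,n\}$, let $J_{2n}$ be the $2n\times 2n$ matrix (indexed by $[-n;n]$) with ones on the anti-diagonal and zeros elsewhere, and let $\mathfrak o_{2n}=\{X: X^TJ_{2n}+J_{2n}X=0\}$ (complex matrices), with elements $F_{i,j}=E_{i,j}-E_{-j,-i}$ and form $\langle X,Y\rangle=\frac12\operatorname{tr}(XY)$. Let $\hat{\mathfrak o}_{2n}=\mathfrak o_{2n}[t,t^{-1}]\oplus\mathbb C K$ with $K$ central, $X[r]=Xt^r$ and $[X[r],Y[s]]=[X,Y][r+s]+r\,\delta_{r,-s}\langle X,Y\rangle K$. Let $\mathrm{ad}_\tau$ be the derivation of $U(\hat{\mathfrak o}_{2n})$ with $X[r]\mapsto -rX[r-1]$, $K\mapsto 0$, i.e. $f\mapsto[\tau,f]$ for the extended affine algebra $\hat{\mathfrak o}_{2n}\oplus\mathbb C\tau$. Let $\Lambda$ be the complex exterior algebra generated by $e_i$, $i\in[-n;n]$ ($e_ie_j=-e_je_i$). In $\Lambda\otimes U(\hat{\mathfrak o}_{2n})$, in which the $e_i$ commute with $U(\hat{\mathfrak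 o}_{2n})$, put $$\Omega[r]=\sum_{i,j\in[-n;n]}e_ie_{-j}F_{i,j}[r],\quad \Theta[r]=\sum_{i=-n}^{-1}\sum_{j=1}^{n}e_ie_{-j}F_{i,j}[r],\quad \tilde\Theta[r]=\sum_{i=1}^{n}\sum_{j=-n}^{-1}e_ie_{-j}F_{i,j}[r],$$ $$\Xi[r]=\sum_{i,j=-n}^{-1}e_ie_{-j}F_{i,j}[r],\qquad \Psi=\sum_{j=1}^n e_je_{-j}.$$ For a partition $\alpha=(a_1\ge\dots\ge a_l>0)=(1^{m_1},2^{m_2},\dots)$ of length $l(\alpha)=l$ put $\Theta[-\alpha]=\Theta[-a_1]\cdots\Theta[-a_l]$ and $\tilde\Theta[-\alpha]=\tilde\Theta[-a_1]\cdots\tilde\Theta[-a_l]$ (equal to $1$ for the empty partition). Let $\mathrm{ad}_\tau$ act on $\Lambda\otimes U(\hat{\mathfrak o}_{2n})$ through the second factor. **Theorem.** $$\Omega[-1]^n=\sum_{l=0}^{\lfloor n/2\rfloor}\ \sum_{\substack{a,b\ge 0\\ 2l\le a+b\le n}}\frac{2^{n-2l}\,n!}{(n-a-b)!}\Big(\sum_{\alpha\vdash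 a,\ l(\alpha)=l}\frac{1}{m_1!m_2!\cdots}\tilde\Theta[-\alpha]\Big)(-\Psi)^{a+b-2l}\Big((\Xi[-1]-\Psi\,\mathrm{ad}_\tau)^{n-a-b}\cdot 1\Big)\Big(\sum_{\beta\vdash b,\ l(\beta)=l}\frac{1}{m_1'!m_2'!\cdots}\Theta[-\beta]\Big),$$ where $\alpha=(1^{m_1},2^{m_2},\dots)$ and $\beta=(1^{m'_1},2^{m'_2},\dots)$. Moreover $$\Omega[-1]^n=e_{-n}e_{-n+1}\cdots e_{-1}e_1\cdots e_n\;2^n\,n!\;\operatorname{Pf}\tilde F[-1],$$ where $\tilde F[-1]=F[-1]J_{2n}$, $F[-1]=(F_{i,j}[-1])_{i,j\in[-n;n]}$, and $$\operatorname{Pf}\tilde F[-1]=\frac1{2^nn!}\sum_{\sigma}\operatorname{sgn}(\sigma)\,\tilde F_{\sigma(-n),\sigma(-n+1)}[-1]\cdots\tilde F_{\sigma(n-1),\sigma(n)}[-1]$$ (sum over all permutations of $[-n;n]$), so that the sum above is a combinatorial formula for $\operatorname{Pf}\tilde F[-1]$. -/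

import Mathlib

open scoped TensorProduct Nat

namespace AffineOrthogonal

noncomputable section

attribute [local instance 100] LieRing.ofAssociativeRing

/-! ### Affinization of a Lie algebra with an invariant form -/

/-- The affine Lie algebra `L[t,t⁻¹] ⊕ ℂK` of a Lie algebra `L` with a symmetric invariant form
`⟨,⟩ = -Φ`; its bracket is `[X[r], Y[s]] = [X,Y][r+s] + r δ_{r,-s} ⟨X,Y⟩ K`. (The residue cocycle
of `Φ` takes the value `s δ_{r,-s} Φ(X,Y)` on `(X[r], Y[s])`, whence the sign of the form.) -/
def Affine {L : Type} [LieRing L] [LieAlgebra ℂ L] (Φ : LinearMap.BilinForm ℂ L)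
    (h₁ : Φ.lieInvariant L) (h₂ : Φ.IsSymm) : Type :=
  LieAlgebra.ofTwoCocycle (LieAlgebra.LoopAlgebra.twoCocycleOfBilinear ℂ ℤ L Φ h₁ h₂)

section

variable {L : Type} [LieRing L] [LieAlgebra ℂ L] {Φ : LinearMap.BilinForm ℂ L}
  {h₁ : Φ.lieInvariant L} {h₂ : Φ.IsSymm}

instance : LieRing (Affine Φ h₁ h₂) := inferInstanceAs (LieRing (LieAlgebra.ofTwoCocycle _))

instance : LieAlgebra ℂ (Affine Φ h₁ h₂) :=
  inferInstanceAs (LieAlgebra ℂ (LieAlgebra.ofTwoCocycle _))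

/-- The element of the affine algebra with given components in `L[t,t⁻¹]` and `ℂK`. -/
def mk : (LieAlgebra.loopAlgebra ℂ ℤ L × ℂ) ≃ₗ[ℂ] Affine Φ h₁ h₂ where
  toFun x := LieAlgebra.ofProd _ (x.1, (TrivialLieModule.equiv ℂ _ ℂ).symm x.2)
  invFun x := (((LieAlgebra.ofProd _).symm x).1,
    TrivialLieModule.equiv ℂ _ ℂ ((LieAlgebra.ofProd _).symm x).2)
  left_inv _ := rfl
  right_inv _ := rfl
  map_add' _ _ := rfl
  map_smul' _ _ := rfl

theorem lie_mk (x y : LieAlgebra.loopAlgebra ℂ ℤ L × ℂ) :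
    ⁅(mk x : Affine Φ h₁ h₂), (mk y : Affine Φ h₁ h₂)⁆ =
      mk (⁅x.1, y.1⁆, LieAlgebra.LoopAlgebra.residuePairing ℂ ℤ L Φ x.1 y.1) := by
  refine congrArg (LieAlgebra.ofProd _) (Prod.ext rfl ?_)
  change (TrivialLieModule.equiv ℂ (LieAlgebra.loopAlgebra ℂ ℤ L) ℂ).symm
    (LieAlgebra.LoopAlgebra.residuePairing ℂ ℤ L Φ x.1 y.1) + 0 - 0 = _
  rw [add_zero, sub_zero]

/-- The element `X[r] = X t^r`. -/
def mode (X : L) (r : ℤ) : Affine Φ h₁ h₂ := mk (AddMonoidAlgebra.single r (1 : ℂ) ⊗ₜ[ℂ] X, 0)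

/-- The central element `K`. -/
def K : Affine Φ h₁ h₂ := mk (0, 1)

theorem residue_mode (X Y : L) (r s : ℤ) :
    LieAlgebra.LoopAlgebra.residuePairing ℂ ℤ L Φ
      (AddMonoidAlgebra.single r (1 : ℂ) ⊗ₜ[ℂ] X) (AddMonoidAlgebra.single s (1 : ℂ) ⊗ₜ[ℂ] Y) =
    (r : ℂ) * (if r = -s then 1 else 0) * -Φ X Y := by
  rw [LieAlgebra.LoopAlgebra.residuePairing_apply_apply,
    LieAlgebra.LoopAlgebra.toFinsupp_single_tmul, LieAlgebra.LoopAlgebra.toFinsupp_single_tmul,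
    Finsupp.sum_single_index (by rw [map_zero, smul_zero]), Finsupp.single_apply]
  by_cases h : r = -s
  · rw [if_pos h, if_pos h, h, zsmul_eq_mul]
    push_cast
    ring
  · rw [if_neg h, if_neg h, map_zero, LinearMap.zero_apply, smul_zero]
    ring

theorem lie_mode (X Y : L) (r s : ℤ) :
    ⁅(mode X r : Affine Φ h₁ h₂), (mode Y s : Affine Φ h₁ h₂)⁆ =
      mode ⁅X, Y⁆ (r + s) + ((r : ℂ) * (if r = -s then 1 else 0) * -Φ X Y) •
        (K : Affine Φ h₁ h₂) := by
  rw [mode, mode, mode, K, lie_mk, residue_mode, ← map_smul, ← map_add,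
    LieAlgebra.ExtendScalars.bracket_tmul, AddMonoidAlgebra.single_mul_single, mul_one,
    Prod.smul_mk, smul_zero, Prod.mk_add_mk, add_zero, zero_add, smul_eq_mul, mul_one]

theorem lie_K (x : Affine Φ h₁ h₂) : ⁅x, (K : Affine Φ h₁ h₂)⁆ = 0 := by
  obtain ⟨x, rfl⟩ := (mk : _ ≃ₗ[ℂ] Affine Φ h₁ h₂).surjective x
  rw [K, lie_mk, ← map_zero (mk : _ ≃ₗ[ℂ] Affine Φ h₁ h₂)]
  exact congrArg mk (Prod.ext (lie_zero x.1) (map_zero _))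

theorem mode_neg (X : L) (r : ℤ) : (mode (-X) r : Affine Φ h₁ h₂) = -mode X r := by
  rw [mode, mode, TensorProduct.tmul_neg, ← map_neg, Prod.neg_mk, neg_zero]

/-- The operator `-d/dt` on Laurent polynomials: `t^r ↦ -r t^(r-1)`. -/
def negDeriv : AddMonoidAlgebra ℂ ℤ →ₗ[ℂ] AddMonoidAlgebra ℂ ℤ :=
  (Finsupp.lsum ℂ fun r : ℤ => (-(r : ℂ)) • AddMonoidAlgebra.lsingle (r - 1)) ∘ₗ
    (AddMonoidAlgebra.coeffLinearEquiv ℂ).toLinearMap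

theorem negDeriv_single (r : ℤ) (c : ℂ) :
    negDeriv (AddMonoidAlgebra.single r c) = AddMonoidAlgebra.single (r - 1) (-(r : ℂ) * c) := by
  simp only [negDeriv, LinearMap.comp_apply]
  erw [Finsupp.lsum_single]
  simp only [LinearMap.smul_apply, AddMonoidAlgebra.lsingle_apply, AddMonoidAlgebra.smul_single,
    smul_eq_mul]

/-- The linear map `X[r] ↦ -r X[r-1]`, `K ↦ 0` of the affine algebra. -/
def tauLin : Affine Φ h₁ h₂ →ₗ[ℂ] Affine Φ h₁ h₂ :=
  mk.toLinearMap ∘ₗ ((negDeriv.rTensor L).prodMap 0) ∘ₗ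
    (mk : _ ≃ₗ[ℂ] Affine Φ h₁ h₂).symm.toLinearMap

theorem tauLin_mk (x : LieAlgebra.loopAlgebra ℂ ℤ L × ℂ) :
    tauLin (mk x : Affine Φ h₁ h₂) = mk (negDeriv.rTensor L x.1, 0) := by
  change mk ((negDeriv.rTensor L).prodMap 0 ((mk : _ ≃ₗ[ℂ] Affine Φ h₁ h₂).symm (mk x))) = _
  rw [LinearEquiv.symm_apply_apply]
  rfl

theorem tauLin_mode (X : L) (r : ℤ) :
    tauLin (mode X r : Affine Φ h₁ h₂) = (-(r : ℂ)) • (mode X (r - 1) : Affine Φ h₁ h₂) := by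
  rw [mode, mode, tauLin_mk, LinearMap.rTensor_tmul, negDeriv_single, ← map_smul, Prod.smul_mk,
    smul_zero, TensorProduct.smul_tmul', AddMonoidAlgebra.smul_single, smul_eq_mul]

theorem tauLin_K : tauLin (K : Affine Φ h₁ h₂) = 0 := by
  rw [K, tauLin_mk, map_zero, Prod.mk_zero_zero, map_zero]

/-- The elements `X[r]` and `K` span the affine algebra. -/
theorem affine_induction {p : Affine Φ h₁ h₂ → Prop} (hm : ∀ X r, p (mode X r))
    (hK : ∀ c : ℂ, p (c • (K : Affine Φ h₁ h₂)))
    (ha : ∀ x y, p x → p y → p (x + y)) (x : Affine Φ h₁ h₂) : p x := by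
  have h0 : p 0 := by rw [← zero_smul ℂ (K : Affine Φ h₁ h₂)]; exact hK 0
  have key : ∀ f : LieAlgebra.loopAlgebra ℂ ℤ L, p (mk (f, 0)) := by
    intro f
    induction f using TensorProduct.induction_on with
    | zero => rw [Prod.mk_zero_zero, map_zero]; exact h0
    | tmul f X =>
      induction f using AddMonoidAlgebra.induction_linear with
      | zero => rw [TensorProduct.zero_tmul, Prod.mk_zero_zero, map_zero]; exact h0
      | add f g hf hg =>
        have := ha _ _ hf hg
        rwa [← map_add, Prod.mk_add_mk, add_zero, ← TensorProduct.add_tmul] at this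
      | single r c =>
        have h := hm (c • X) r
        rwa [mode, TensorProduct.tmul_smul, TensorProduct.smul_tmul',
          AddMonoidAlgebra.smul_single, smul_eq_mul, mul_one] at h
    | add f g hf hg =>
      have := ha _ _ hf hg
      rwa [← map_add, Prod.mk_add_mk, add_zero] at this
  obtain ⟨⟨f, c⟩, rfl⟩ := (mk : _ ≃ₗ[ℂ] Affine Φ h₁ h₂).surjective x
  have := ha _ _ (key f) (hK c)
  rwa [K, ← map_smul, ← map_add, Prod.smul_mk, smul_zero, Prod.mk_add_mk, add_zero, zero_add,
    smul_eq_mul, mul_one] at this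

/-- The derivation `X[r] ↦ -r X[r-1]`, `K ↦ 0` of the affine algebra. -/
def tauDer : LieDerivation ℂ (Affine Φ h₁ h₂) (Affine Φ h₁ h₂) where
  toLinearMap := tauLin
  leibniz' x y := by
    induction x using affine_induction with
    | hK c =>
      rw [← lie_skew, lie_smul, lie_K, map_smul, tauLin_K, ← lie_skew, lie_smul, lie_K]
      simp
    | ha x x' hx hx' =>
      rw [add_lie, map_add, hx, hx', map_add, add_lie, lie_add]
      abel
    | hm X r =>
      induction y using affine_induction with
      | hK c =>
        rw [lie_smul, lie_K, map_smul tauLin c K, tauLin_K, ← lie_skew (c • K),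
          lie_smul, lie_smul, lie_K (tauLin (mode X r)), smul_zero, map_zero, lie_zero,
          smul_zero, neg_zero, sub_zero]
      | ha x x' hx hx' =>
        rw [lie_add, map_add, hx, hx', map_add, add_lie, lie_add]
        abel
      | hm Y s =>
        have e₁ : r + (s - 1) = r + s - 1 := by ring
        have e₂ : s + (r - 1) = r + s - 1 := by ring
        have e₃ : (if s = -(r - 1) then (1 : ℂ) else 0) = if r = -(s - 1) then 1 else 0 :=
          if_congr (by omega) rfl rfl
        have e₄ : tauLin (⁅(mode X r : Affine Φ h₁ h₂), (mode Y s : Affine Φ h₁ h₂)⁆) =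
            (-((r + s : ℤ) : ℂ)) • (mode ⁅X, Y⁆ (r + s - 1) : Affine Φ h₁ h₂) := by
          rw [lie_mode, map_add, map_smul, tauLin_K, tauLin_mode, smul_zero, add_zero]
        rw [e₄, tauLin_mode, tauLin_mode, lie_smul, lie_smul, lie_mode, lie_mode, e₁, e₂, e₃,
          h₂.eq Y X, ← lie_skew Y X, mode_neg]
        generalize (mode ⁅X, Y⁆ (r + s - 1) : Affine Φ h₁ h₂) = m
        generalize (K : Affine Φ h₁ h₂) = k
        generalize (if r = -(s - 1) then (1 : ℂ) else 0) = q
        push_cast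
        module

end

/-! ### Derivations of universal enveloping algebras -/

section

variable {G : Type} [LieRing G] [LieAlgebra ℂ G] (D : LieDerivation ℂ G G)

/-- The algebra map `x ↦ x + ε D(x)` (for `x ∈ G`) to the dual numbers over the enveloping
algebra. -/
def dualLift : UniversalEnvelopingAlgebra ℂ G →ₐ[ℂ] TrivSqZeroExt (UniversalEnvelopingAlgebra ℂ G) (UniversalEnvelopingAlgebra ℂ G) :=
  UniversalEnvelopingAlgebra.lift ℂ
    { toFun := fun x => TrivSqZeroExt.inl (UniversalEnvelopingAlgebra.ι ℂ x) +
        TrivSqZeroExt.inr (UniversalEnvelopingAlgebra.ι ℂ (D x))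
      map_add' := fun x y => by
        ext <;> simp only [map_add, TrivSqZeroExt.fst_add, TrivSqZeroExt.snd_add,
          TrivSqZeroExt.fst_inl, TrivSqZeroExt.snd_inl, TrivSqZeroExt.fst_inr,
          TrivSqZeroExt.snd_inr, zero_add, add_zero]
      map_smul' := fun c x => by
        ext <;> simp only [map_smul, TrivSqZeroExt.fst_add, TrivSqZeroExt.snd_add,
          TrivSqZeroExt.fst_smul, TrivSqZeroExt.snd_smul, RingHom.id_apply,
          TrivSqZeroExt.fst_inl, TrivSqZeroExt.snd_inl, TrivSqZeroExt.fst_inr,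
          TrivSqZeroExt.snd_inr, zero_add, add_zero]
      map_lie' := fun {x y} => by
        ext
        · simp only [LieHom.map_lie, LieRing.of_associative_ring_bracket, TrivSqZeroExt.fst_add,
            TrivSqZeroExt.fst_sub, TrivSqZeroExt.fst_mul, TrivSqZeroExt.fst_inl,
            TrivSqZeroExt.fst_inr, add_zero]
        · simp only [LieDerivation.apply_lie_eq_sub, map_sub, LieHom.map_lie,
            LieRing.of_associative_ring_bracket, TrivSqZeroExt.snd_add, TrivSqZeroExt.fst_add,
            TrivSqZeroExt.snd_sub, TrivSqZeroExt.snd_mul, TrivSqZeroExt.fst_inl,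
            TrivSqZeroExt.fst_inr, TrivSqZeroExt.snd_inl, TrivSqZeroExt.snd_inr, add_zero,
            zero_add, smul_eq_mul, MulOpposite.smul_eq_mul_unop, MulOpposite.unop_op]
          abel }

/-- The derivation of the enveloping algebra that extends the derivation `D` of `G`. -/
def derLift : UniversalEnvelopingAlgebra ℂ G →ₗ[ℂ] UniversalEnvelopingAlgebra ℂ G :=
  (TrivSqZeroExt.sndHom (UniversalEnvelopingAlgebra ℂ G) (UniversalEnvelopingAlgebra ℂ G)).restrictScalars ℂ ∘ₗ (dualLift D).toLinearMap

theorem derLift_ι (x : G) :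
    derLift D (UniversalEnvelopingAlgebra.ι ℂ x) = UniversalEnvelopingAlgebra.ι ℂ (D x) := by
  change (dualLift D (UniversalEnvelopingAlgebra.ι ℂ x)).snd = _
  rw [dualLift, UniversalEnvelopingAlgebra.lift_ι_apply, LieHom.coe_mk, TrivSqZeroExt.snd_add,
    TrivSqZeroExt.snd_inl, TrivSqZeroExt.snd_inr, zero_add]

theorem fst_dualLift (u : (UniversalEnvelopingAlgebra ℂ G)) : (dualLift D u).fst = u := by
  have h : (TrivSqZeroExt.fstHom ℂ (UniversalEnvelopingAlgebra ℂ G) (UniversalEnvelopingAlgebra ℂ G)).comp (dualLift D) = AlgHom.id ℂ (UniversalEnvelopingAlgebra ℂ G) := by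
    apply UniversalEnvelopingAlgebra.hom_ext
    ext x
    change (dualLift D (UniversalEnvelopingAlgebra.ι ℂ x)).fst = UniversalEnvelopingAlgebra.ι ℂ x
    rw [dualLift, UniversalEnvelopingAlgebra.lift_ι_apply, LieHom.coe_mk, TrivSqZeroExt.fst_add,
      TrivSqZeroExt.fst_inl, TrivSqZeroExt.fst_inr, add_zero]
  exact DFunLike.congr_fun h u

theorem uea_induction {p : UniversalEnvelopingAlgebra ℂ G → Prop} (h1 : ∀ c : ℂ, p (algebraMap ℂ (UniversalEnvelopingAlgebra ℂ G) c))
    (hι : ∀ x : G, p (UniversalEnvelopingAlgebra.ι ℂ x)) (ha : ∀ u v, p u → p v → p (u + v))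
    (hm : ∀ u v, p u → p v → p (u * v)) (u : (UniversalEnvelopingAlgebra ℂ G)) : p u := by
  let S : Subalgebra ℂ (UniversalEnvelopingAlgebra ℂ G) :=
    { carrier := {u | p u}
      mul_mem' := fun {a b} => hm a b
      add_mem' := fun {a b} => ha a b
      algebraMap_mem' := h1 }
  let f : G →ₗ⁅ℂ⁆ S :=
    { toFun := fun x => ⟨UniversalEnvelopingAlgebra.ι ℂ x, hι x⟩
      map_add' := fun x y => Subtype.ext (map_add _ x y)
      map_smul' := fun c x => Subtype.ext (map_smul _ c x)
      map_lie' := fun {x y} => Subtype.ext (LieHom.map_lie _ x y) }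
  have h : S.val.comp (UniversalEnvelopingAlgebra.lift ℂ f) = AlgHom.id ℂ (UniversalEnvelopingAlgebra ℂ G) := by
    apply UniversalEnvelopingAlgebra.hom_ext
    ext x
    change ((UniversalEnvelopingAlgebra.lift ℂ f (UniversalEnvelopingAlgebra.ι ℂ x) : S) : (UniversalEnvelopingAlgebra ℂ G)) =
      UniversalEnvelopingAlgebra.ι ℂ x
    rw [UniversalEnvelopingAlgebra.lift_ι_apply]
    rfl
  have hu := (UniversalEnvelopingAlgebra.lift ℂ f u).2
  have h2 : ((UniversalEnvelopingAlgebra.lift ℂ f u : S) : (UniversalEnvelopingAlgebra ℂ G)) = u := DFunLike.congr_fun h u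
  rw [h2] at hu
  exact hu

theorem derLift_mul (u v : (UniversalEnvelopingAlgebra ℂ G)) : derLift D (u * v) = derLift D u * v + u * derLift D v := by
  change (dualLift D (u * v)).snd = (dualLift D u).snd * v + u * (dualLift D v).snd
  rw [map_mul, TrivSqZeroExt.snd_mul, fst_dualLift, fst_dualLift, smul_eq_mul,
    MulOpposite.smul_eq_mul_unop, MulOpposite.unop_op, add_comm]

/-- The semidirect sum `G ⊕ ℂτ` with `[τ, x] = D x` for `x ∈ G`. -/
abbrev ExtendBy : Type :=
  LieAlgebra.SemiDirectSum (R := ℂ) G ℂ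
    { toFun := fun c => c • D
      map_add' := fun a b => add_smul a b _
      map_smul' := fun a b => by rw [smul_eq_mul, mul_smul, RingHom.id_apply]
      map_lie' := fun {a b} => by
        rw [LieRing.of_associative_ring_bracket, mul_comm, sub_self, zero_smul, smul_lie, lie_smul,
          lie_self, smul_zero, smul_zero] }

/-- The element `τ` of `G ⊕ ℂτ`. -/
def tau : ExtendBy D := ⟨0, 1⟩

/-- The algebra map between enveloping algebras induced by the inclusion of `G` into `G ⊕ ℂτ`. -/
def toExt : UniversalEnvelopingAlgebra ℂ G →ₐ[ℂ] UniversalEnvelopingAlgebra ℂ (ExtendBy D) :=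
  UniversalEnvelopingAlgebra.lift ℂ
    ((UniversalEnvelopingAlgebra.ι ℂ).comp (LieAlgebra.SemiDirectSum.inl _))

/-- In the enveloping algebra of `G ⊕ ℂτ`, the derivation is the commutator with `τ`. -/
theorem toExt_derLift (u : (UniversalEnvelopingAlgebra ℂ G)) :
    toExt D (derLift D u) =
      UniversalEnvelopingAlgebra.ι ℂ (tau D) * toExt D u -
        toExt D u * UniversalEnvelopingAlgebra.ι ℂ (tau D) := by
  induction u using uea_induction with
  | h1 c =>
    have h : derLift D (algebraMap ℂ (UniversalEnvelopingAlgebra ℂ G) c) = 0 := by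
      change (dualLift D (algebraMap ℂ (UniversalEnvelopingAlgebra ℂ G) c)).snd = 0
      rw [AlgHom.commutes]
      rfl
    rw [h, map_zero, AlgHom.commutes, Algebra.commutes, sub_self]
  | hι x =>
    rw [derLift_ι, toExt, UniversalEnvelopingAlgebra.lift_ι_apply,
      UniversalEnvelopingAlgebra.lift_ι_apply, LieHom.comp_apply, LieHom.comp_apply,
      ← LieRing.of_associative_ring_bracket, ← LieHom.map_lie]
    congr 1
    simp [tau]
  | ha u v hu hv =>
    rw [map_add, map_add, hu, hv, map_add, mul_add, add_mul]
    abel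
  | hm u v hu hv =>
    rw [derLift_mul, map_add, map_mul, map_mul, hu, hv, map_mul]
    noncomm_ring

end

/-! ### The even orthogonal Lie algebra -/

/-- The index set `[-n;n] = {-n, …, -1, 1, …, n}`. -/
abbrev Idx (n : ℕ) : Type := {i : ℤ // i ∈ (Finset.Icc (-(n : ℤ)) n).erase 0}

/-- The involution `i ↦ -i` of `[-n;n]`. -/
instance instNegIdx (n : ℕ) : Neg (Idx n) :=
  ⟨fun i => ⟨-i.1, by
    have h := i.2
    simp only [Finset.mem_erase, Finset.mem_Icc, ne_eq] at h ⊢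
    omega⟩⟩

@[simp] theorem coe_neg_idx {n : ℕ} (i : Idx n) : ((-i : Idx n) : ℤ) = -(i : ℤ) := rfl

instance instInvolutiveNegIdx (n : ℕ) : InvolutiveNeg (Idx n) :=
  ⟨fun i => Subtype.ext (by simp)⟩

/-- The `k`-th element (counting from `0`) of `[-n;n]` in increasing order. -/
def enum (n : ℕ) (k : Fin (2 * n)) : Idx n :=
  ⟨if (k : ℕ) < n then (k : ℤ) - n else (k : ℤ) - n + 1, by
    have h := k.2
    simp only [Finset.mem_erase, Finset.mem_Icc, ne_eq]
    split_ifs <;> omega⟩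

/-- The symmetric matrix `J_{2n}` with ones on the anti-diagonal and zeros elsewhere. -/
def J (n : ℕ) : Matrix (Idx n) (Idx n) ℂ := fun i j => if j = -i then 1 else 0

/-- The Lie algebra `𝔬_{2n}` of complex matrices `X` such that `XᵀJ + JX = 0`. -/
abbrev so (n : ℕ) : LieSubalgebra ℂ (Matrix (Idx n) (Idx n) ℂ) :=
  skewAdjointMatricesLieSubalgebra (J n)

/-- The matrix `E_{i,j} - E_{-j,-i}`. -/
def FMat {n : ℕ} (i j : Idx n) : Matrix (Idx n) (Idx n) ℂ :=
  Matrix.single i j 1 - Matrix.single (-j) (-i) 1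

theorem single_mul_J {n : ℕ} (i j : Idx n) :
    Matrix.single i j (1 : ℂ) * J n = Matrix.single i (-j) 1 := by
  ext a b
  simp only [Matrix.mul_apply, J, Matrix.single_apply, ite_and, ite_mul, one_mul, zero_mul]
  by_cases h : i = a <;> simp [h, eq_comm (a := b)]

theorem J_mul_single {n : ℕ} (i j : Idx n) :
    J n * Matrix.single i j (1 : ℂ) = Matrix.single (-i) j 1 := by
  ext a b
  have h : i = -a ↔ -i = a := ⟨fun h => by rw [h, neg_neg], fun h => by rw [← h, neg_neg]⟩
  simp only [Matrix.mul_apply, J, Matrix.single_apply, ite_mul, one_mul, zero_mul,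
    Finset.sum_ite_eq', Finset.mem_univ, if_true, h]

theorem FMat_mem {n : ℕ} (i j : Idx n) : FMat i j ∈ so n := by
  rw [mem_skewAdjointMatricesLieSubalgebra, mem_skewAdjointMatricesSubmodule]
  change (FMat i j).transpose * J n = J n * (-(FMat i j))
  rw [FMat, Matrix.transpose_sub, Matrix.transpose_single, Matrix.transpose_single, neg_sub,
    Matrix.sub_mul, Matrix.mul_sub, single_mul_J, single_mul_J, J_mul_single, J_mul_single,
    neg_neg]

/-- The generator `F_{i,j} = E_{i,j} - E_{-j,-i}` of `𝔬_{2n}`. -/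
def F {n : ℕ} (i j : Idx n) : so n := ⟨FMat i j, FMat_mem i j⟩

/-- The bilinear form `⟨X, Y⟩ = ½ tr (XY)` on `𝔬_{2n}`. -/
def form (n : ℕ) : LinearMap.BilinForm ℂ (so n) :=
  LinearMap.mk₂ ℂ
    (fun X Y => (1 / 2 : ℂ) *
      Matrix.trace ((X : Matrix (Idx n) (Idx n) ℂ) * (Y : Matrix (Idx n) (Idx n) ℂ)))
    (by intros; simp [add_mul, mul_add]) (by intros; simp; ring)
    (by intros; simp [mul_add]) (by intros; simp; ring)

theorem form_apply {n : ℕ} (X Y : so n) : form n X Y = (1 / 2 : ℂ) *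
    Matrix.trace ((X : Matrix (Idx n) (Idx n) ℂ) * (Y : Matrix (Idx n) (Idx n) ℂ)) := rfl

theorem form_symm (n : ℕ) : (-form n).IsSymm := by
  refine ⟨fun X Y => ?_⟩
  simp [form_apply, Matrix.trace_mul_comm (X : Matrix (Idx n) (Idx n) ℂ)]

theorem form_invariant (n : ℕ) : (-form n).lieInvariant (so n) := by
  intro X Y Z
  simp only [LinearMap.neg_apply, form_apply, LieSubalgebra.coe_bracket,
    LieRing.of_associative_ring_bracket, sub_mul, mul_sub, Matrix.trace_sub, neg_neg]
  have h : Matrix.trace (Y.1 * (Z.1 * X.1)) = Matrix.trace (X.1 * Y.1 * Z.1) := by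
    rw [← mul_assoc, Matrix.trace_mul_comm, mul_assoc]
  rw [h, ← mul_assoc]
  ring

/-! ### The affine Kac--Moody algebra -/

/-- The affine Kac--Moody algebra `𝔬_{2n}[t,t⁻¹] ⊕ ℂK` with bracket
`[X[r], Y[s]] = [X,Y][r+s] + r δ_{r,-s} ⟨X,Y⟩ K`. -/
abbrev Hat (n : ℕ) : Type := Affine (-form n) (form_invariant n) (form_symm n)

/-- The universal enveloping algebra of the affine Kac--Moody algebra. -/
abbrev U (n : ℕ) : Type := UniversalEnvelopingAlgebra ℂ (Hat n)

/-- The operator `ad_τ : f ↦ [τ, f]` on the enveloping algebra of the affine algebra, that is,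
the derivation with `X[r] ↦ -r X[r-1]` and `K ↦ 0`. -/
def adTau (n : ℕ) : U n →ₗ[ℂ] U n := derLift tauDer

/-- The extended affine Kac--Moody algebra `(𝔬_{2n}[t,t⁻¹] ⊕ ℂK) ⊕ ℂτ`, in which
`[τ, X[r]] = -r X[r-1]` and `[τ, K] = 0`. -/
abbrev Ext (n : ℕ) : Type := ExtendBy (tauDer : LieDerivation ℂ (Hat n) (Hat n))

/-- The generator `F_{i,j}[r]` in the enveloping algebra; these are the entries of `F[r]`. -/
def Fmode {n : ℕ} (r : ℤ) : Matrix (Idx n) (Idx n) (U n) :=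
  fun i j => UniversalEnvelopingAlgebra.ι ℂ (mode (F i j) r)

/-- The matrix `F̃[r] = F[r] J_{2n}`. -/
def Ftilde (n : ℕ) (r : ℤ) : Matrix (Idx n) (Idx n) (U n) :=
  Fmode r * (J n).map (algebraMap ℂ (U n))

/-- The Pfaffian `Pf F̃[-1]`. -/
def Pf (n : ℕ) : U n :=
  (1 / ((2 : ℂ) ^ n * (n ! : ℂ))) • ∑ σ : Equiv.Perm (Idx n),
    ((Equiv.Perm.sign σ : ℤ) : ℂ) • (List.ofFn fun k : Fin n =>
      Ftilde n (-1) (σ (enum n ⟨2 * k, by omega⟩)) (σ (enum n ⟨2 * k + 1, by omega⟩))).prod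

/-! ### Forms with values in the enveloping algebra -/

/-- The exterior algebra `Λ` on the generators `e_i`, `i ∈ [-n;n]`. -/
abbrev Lam (n : ℕ) : Type := ExteriorAlgebra ℂ (Idx n → ℂ)

/-- The generator `e_i` of the exterior algebra. -/
def e {n : ℕ} (i : Idx n) : Lam n := ExteriorAlgebra.ι ℂ (Pi.single i 1)

/-- The algebra `Λ ⊗ U`; the elements `e_i` commute with those of `U`. -/
abbrev LU (n : ℕ) : Type := Lam n ⊗[ℂ] U n

/-- The two-form `∑ e_i e_{-j} F_{i,j}[r]`, over `i` with `p i` and `j` with `q j`. -/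
def twoForm (n : ℕ) (p q : Idx n → Prop) [DecidablePred p] [DecidablePred q] (r : ℤ) : LU n :=
  ∑ i with p i, ∑ j with q j, (e i * e (-j)) ⊗ₜ[ℂ] Fmode r i j

/-- `Ω[r] = ∑_{i,j} e_i e_{-j} F_{i,j}[r]`, over all `i, j`. -/
def Omega (n : ℕ) (r : ℤ) : LU n := ∑ i : Idx n, ∑ j : Idx n, (e i * e (-j)) ⊗ₜ[ℂ] Fmode r i j

/-- `Θ[r]`: the part of `Ω[r]` with `i < 0 < j`. -/
def Theta (n : ℕ) (r : ℤ) : LU n := twoForm n (fun i => i.1 < 0) (fun j => 0 < j.1) r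

/-- `Θ̃[r]`: the part of `Ω[r]` with `j < 0 < i`. -/
def ThetaTilde (n : ℕ) (r : ℤ) : LU n := twoForm n (fun i => 0 < i.1) (fun j => j.1 < 0) r

/-- `Ξ[r]`: the part of `Ω[r]` with `i, j < 0`. -/
def Xi (n : ℕ) (r : ℤ) : LU n := twoForm n (fun i => i.1 < 0) (fun j => j.1 < 0) r

/-- `Ψ = ∑_{j > 0} e_j e_{-j}`. -/
def Psi (n : ℕ) : LU n := ∑ j : Idx n with 0 < j.1, (e j * e (-j)) ⊗ₜ[ℂ] (1 : U n)

/-- The operator `Ξ[-1] - Ψ ad_τ` on `Λ ⊗ U`, where `ad_τ` acts on the second factor. -/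
def XiPsi (n : ℕ) : Module.End ℂ (LU n) :=
  LinearMap.mulLeft ℂ (Xi n (-1)) -
    LinearMap.mulLeft ℂ (Psi n) ∘ₗ (adTau n).lTensor (Lam n)

/-- For a partition `α = (a₁ ≥ … ≥ a_l > 0)`, the product `T[-a₁] ⋯ T[-a_l]`. -/
def partProd {n a : ℕ} (T : ℤ → LU n) (α : Nat.Partition a) : LU n :=
  ((α.parts.sort (· ≥ ·)).map fun k => T (-(k : ℤ))).prod

/-- For a partition `α = (1^{m₁}, 2^{m₂}, …)`, the number `m₁! m₂! ⋯`. -/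
def multFactorial {a : ℕ} (α : Nat.Partition a) : ℕ :=
  ∏ k ∈ α.parts.toFinset, (α.parts.count k)!

/-- The sum over the partitions `α` of `a` of length `l` of `(m₁! m₂! ⋯)⁻¹ T[-α]`. -/
def partSum {n : ℕ} (T : ℤ → LU n) (a l : ℕ) : LU n :=
  ∑ α : Nat.Partition a with Multiset.card α.parts = l,
    (1 / (multFactorial α : ℂ)) • partProd T α

/-- The product `e_{-n} ⋯ e_{-1} e_1 ⋯ e_n`. -/
def topForm (n : ℕ) : Lam n := (List.ofFn fun k : Fin (2 * n) => e (enum n k)).prod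

end

end AffineOrthogonal

open AffineOrthogonal

/-!
The form `Ω[-1]` equals `Θ[-1] + Θ̃[-1] + 2 Ξ[-1]`, and the modes of `Θ`, `Θ̃` and `Ξ` of negative
degree satisfy the relations
`[Θ[r], Θ̃[s]] = -4 Ψ Ξ[r+s]`, `[Ξ[r], Θ[s]] = 2 Ψ Θ[r+s]`, `[Ξ[r], Θ̃[s]] = -2 Ψ Θ̃[r+s]`
of a current algebra of type `𝔰𝔩₂` in which `Ψ` is central, all other commutators being zero
(`currentRelations`). All of them are instances of one contraction rule (`pairSum_comm`) for
two-forms `∑ e_i e_j F_{i,-j}[r]`, whose coefficients are skew-symmetric in `i` and `j`.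

Over the power series in a central variable `u`, the exponential of `u Ω[-1]` therefore has a Gauss
decomposition `T̃ M T` (`CurrentRelations.gauss_decomposition`), where, with `p = -2 Ψ`,
* `T̃ = exp (∑ pᵃ⁻¹ uᵃ Θ̃[-a])` and `T = exp (∑ pᵃ⁻¹ uᵃ Θ[-a])`, whose coefficients are the sums
  over partitions (`pderiv_partitionSeries`);
* `M' = h M` with `h = 2 ∑ pᵏ uᵏ Ξ[-k-1]`, and the coefficients of `M` are
  `2ᵏ / k! (Ξ[-1] - Ψ ad_τ)ᵏ 1` (`CurrentRelations.pderiv_eq_cartan_mul`).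
Here primes on series are derivatives in `u`. No inverse is needed: the factors are moved past each
other by the uniqueness of the solution of `Z' = Z w` with given constant term. If `q` and `q̃` are
the logarithmic derivatives of `T` and `T̃`, this gives `Ω[-1] T̃ = T̃ (Θ[-1] + q̃ + h)` and
`Θ[-1] M = M q`, and so `T̃ M T` solves the equation `E' = Ω[-1] E` of the exponential.

Comparing the coefficients of `uⁿ` gives a sum over pairs of partitions whose lengths `l` and `l'`
are unrelated. A term with `l ≠ l'` contains more than `n` of the `e_i` with `i > 0` or more than
`n` with `i < 0`, and vanishes (`prod_eq_zero_of_length_ne`).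

For the Pfaffian, `Ω[-1]ⁿ` is expanded over all maps from `2n` positions to the indices. Only the
bijective ones contribute, and reordering the factors `e_i` produces the signs
(`Omega_pow_eq_sum_perm`).
-/

namespace AffineOrthogonal

/-! ### Linear differential equations for power series over a noncommutative ring -/

section

open PowerSeries

theorem commute_of_coeff {R : Type*} [Ring R] {f g : R⟦X⟧}
    (h : ∀ i j, Commute (coeff i f) (coeff j g)) :
    Commute f g := by
  ext n
  rw [coeff_mul, coeff_mul, ← Finset.Nat.sum_antidiagonal_swap]
  exact Finset.sum_congr rfl fun x _ => h _ _

section Series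

variable {R : Type*} [Ring R] [Algebra ℂ R]

/-- The formal derivative of a power series whose coefficients need not commute with each other;
the variable is central. -/
noncomputable def pderiv (f : R⟦X⟧) : R⟦X⟧ :=
  PowerSeries.mk fun n => ((n : ℂ) + 1) • coeff (n + 1) f

theorem coeff_pderiv (f : R⟦X⟧) (n : ℕ) :
    coeff n (pderiv f) = ((n : ℂ) + 1) • coeff (n + 1) f := coeff_mk _ _

theorem pderiv_add (f g : R⟦X⟧) : pderiv (f + g) = pderiv f + pderiv g := by
  ext n
  simp [coeff_pderiv, smul_add]

theorem pderiv_sub (f g : R⟦X⟧) : pderiv (f - g) = pderiv f - pderiv g := by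
  ext n
  simp [coeff_pderiv, smul_sub]

theorem pderiv_C (a : R) : pderiv (C a : R⟦X⟧) = 0 := by
  ext n
  simp [coeff_pderiv]

theorem pderiv_mul (f g : R⟦X⟧) : pderiv (f * g) = pderiv f * g + f * pderiv g := by
  ext n
  have h₁ : ∑ x ∈ Finset.HasAntidiagonal.antidiagonal (n + 1),
      (x.1 : ℂ) • (coeff x.1 f * coeff x.2 g) =
      coeff n (pderiv f * g) := by
    rw [Finset.Nat.sum_antidiagonal_succ, coeff_mul]
    simp [coeff_pderiv]
  have h₂ : ∑ x ∈ Finset.HasAntidiagonal.antidiagonal (n + 1),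
      (x.2 : ℂ) • (coeff x.1 f * coeff x.2 g) =
      coeff n (f * pderiv g) := by
    rw [Finset.Nat.sum_antidiagonal_succ', coeff_mul]
    simp [coeff_pderiv]
  rw [map_add, ← h₁, ← h₂, ← Finset.sum_add_distrib, coeff_pderiv, coeff_mul, Finset.smul_sum]
  refine Finset.sum_congr rfl fun x hx => ?_
  rw [← add_smul]
  congr 1
  exact_mod_cast (Finset.HasAntidiagonal.mem_antidiagonal.1 hx).symm

/-- Uniqueness for the linear differential equation `Z' = Z w`. -/
theorem eq_zero_of_pderiv_eq_mul {Z w : R⟦X⟧} (h0 : coeff 0 Z = 0) (h : pderiv Z = Z * w) :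
    Z = 0 := by
  ext n
  rw [map_zero]
  induction n using Nat.strong_induction_on with
  | _ n ih =>
    rcases n with _ | n
    · exact h0
    · have h1 := congrArg (coeff n) h
      rw [coeff_pderiv, coeff_mul, Finset.sum_eq_zero] at h1
      · exact (smul_eq_zero.1 h1).resolve_left (by exact_mod_cast n.succ_ne_zero)
      · intro x hx
        rw [ih x.1 (Nat.lt_succ_of_le (Finset.HasAntidiagonal.antidiagonal.fst_le hx)), zero_mul]

/-- Uniqueness for the linear differential equation `Z' = w Z`. -/
theorem eq_zero_of_pderiv_eq_mul' {Z w : R⟦X⟧} (h0 : coeff 0 Z = 0) (h : pderiv Z = w * Z) :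
    Z = 0 := by
  ext n
  rw [map_zero]
  induction n using Nat.strong_induction_on with
  | _ n ih =>
    rcases n with _ | n
    · exact h0
    · have h1 := congrArg (coeff n) h
      rw [coeff_pderiv, coeff_mul, Finset.sum_eq_zero] at h1
      · exact (smul_eq_zero.1 h1).resolve_left (by exact_mod_cast n.succ_ne_zero)
      · intro x hx
        rw [ih x.2 (Nat.lt_succ_of_le (Finset.HasAntidiagonal.antidiagonal.snd_le hx)), mul_zero]

/-- The coefficients of the solution of `M' = h M` with constant term `1`. -/
noncomputable def odeCoeff (h : R⟦X⟧) : ℕ → R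
  | 0 => 1
  | n + 1 => ((n : ℂ) + 1)⁻¹ • ∑ i : Fin (n + 1), coeff (n - i) h * odeCoeff h i

theorem exists_pderiv_eq_mul (h : R⟦X⟧) : ∃ M : R⟦X⟧, coeff 0 M = 1 ∧ pderiv M = h * M := by
  refine ⟨PowerSeries.mk (odeCoeff h), by rw [coeff_mk, odeCoeff], ?_⟩
  ext n
  rw [coeff_pderiv, coeff_mk, odeCoeff, smul_inv_smul₀ (by exact_mod_cast n.succ_ne_zero),
    coeff_mul, ← Finset.Nat.sum_antidiagonal_swap, Finset.Nat.sum_antidiagonal_eq_sum_range_succ_mk,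
    Finset.sum_range]
  simp

/-- The action of a linear operator on the coefficients of a power series. -/
noncomputable def coeffMap (D : R →ₗ[ℂ] R) (f : R⟦X⟧) : R⟦X⟧ :=
  PowerSeries.mk fun n => D (coeff n f)

theorem coeff_coeffMap (D : R →ₗ[ℂ] R) (f : R⟦X⟧) (n : ℕ) :
    coeff n (coeffMap D f) = D (coeff n f) := coeff_mk _ _

theorem coeffMap_mul {D : R →ₗ[ℂ] R} (hD : ∀ x y, D (x * y) = D x * y + x * D y) (f g : R⟦X⟧) :
    coeffMap D (f * g) = coeffMap D f * g + f * coeffMap D g := by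
  ext n
  simp only [coeff_coeffMap, coeff_mul, map_add, map_sum, hD, Finset.sum_add_distrib]

theorem pderiv_coeffMap (D : R →ₗ[ℂ] R) (f : R⟦X⟧) :
    pderiv (coeffMap D f) = coeffMap D (pderiv f) := by
  ext n
  simp only [coeff_coeffMap, coeff_pderiv, map_smul]

theorem sum_antidiagonal_snd (n : ℕ) :
    ∑ x ∈ Finset.HasAntidiagonal.antidiagonal n, ((x.2 : ℂ) + 1) = (n + 1) * (n + 2) / 2 := by
  rw [← Finset.Nat.sum_antidiagonal_swap, Finset.Nat.sum_antidiagonal_eq_sum_range_succ_mk]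
  induction n with
  | zero => simp
  | succ n ih =>
    simp only [Prod.snd_swap] at ih ⊢
    rw [Finset.sum_range_succ, ih]
    push_cast
    ring

/-! ### Gauss decomposition in a current algebra of type `𝔰𝔩₂` -/

/-- The relations between the modes `θ k`, `θ' k`, `ξ k` (of `t`-degree `-(k + 1)`) of the two
nilpotent directions and of the Cartan direction of a current algebra of type `𝔰𝔩₂`, the structure
constants being multiples of a central element `p`. Since only modes of negative `t`-degree occur,
no central extension is visible. -/
structure CurrentRelations (p : R) (θ θ' ξ : ℕ → R) : Prop where
  central : ∀ x, Commute p x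
  comm_ξ : ∀ i j, Commute (ξ i) (ξ j)
  θ_θ' : ∀ i j, θ i * θ' j - θ' j * θ i = (2 : ℂ) • (p * ξ (i + j + 1))
  ξ_θ : ∀ i j, ξ i * θ j - θ j * ξ i = -(p * θ (i + j + 1))
  ξ_θ' : ∀ i j, ξ i * θ' j - θ' j * ξ i = p * θ' (i + j + 1)

/-- The series `∑ (k + 1) pᵏ x_k uᵏ`, the logarithmic derivative of `exp (∑ pᵏ x_k uᵏ⁺¹)`. -/
noncomputable def rampSeries (p : R) (x : ℕ → R) : R⟦X⟧ :=
  PowerSeries.mk fun k => ((k : ℂ) + 1) • (p ^ k * x k)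

/-- The series `2 ∑ pᵏ x_k uᵏ`, the logarithmic derivative of the Cartan factor. -/
noncomputable def cartanSeries (p : R) (x : ℕ → R) : R⟦X⟧ :=
  PowerSeries.mk fun k => (2 : ℂ) • (p ^ k * x k)

namespace CurrentRelations

variable {p : R} {θ θ' ξ : ℕ → R}

theorem central_pow (H : CurrentRelations p θ θ' ξ) (k : ℕ) (x : R) : Commute (p ^ k) x :=
  (H.central x).pow_left k

theorem mul_pow_mul (H : CurrentRelations p θ θ' ξ) (i j : ℕ) (x y : R) :
    (p ^ i * x) * (p ^ j * y) = p ^ (i + j) * (x * y) := by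
  rw [mul_assoc, ← mul_assoc x, ← (H.central_pow j x).eq, mul_assoc, ← mul_assoc, ← pow_add]

/-- If `[ξ i, x j] = c p x (i + j + 1)`, then the ramp series `q` of `x` and the Cartan series `h`
of `ξ` satisfy `[h, q] = c q'`. -/
theorem cartan_ramp (H : CurrentRelations p θ θ' ξ) {x : ℕ → R} {c : ℂ}
    (hx : ∀ i j, ξ i * x j - x j * ξ i = c • (p * x (i + j + 1))) :
    cartanSeries p ξ * rampSeries p x - rampSeries p x * cartanSeries p ξ =
      PowerSeries.C (algebraMap ℂ R c) * pderiv (rampSeries p x) := by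
  ext n
  rw [map_sub, coeff_mul, coeff_mul, ← Finset.Nat.sum_antidiagonal_swap (n := n)
    (f := fun y => coeff y.1 (rampSeries p x) * coeff y.2 (cartanSeries p ξ)),
    ← Finset.sum_sub_distrib, coeff_C_mul, coeff_pderiv, rampSeries, coeff_mk]
  have key : ∀ y ∈ Finset.HasAntidiagonal.antidiagonal n,
      coeff y.1 (cartanSeries p ξ) * coeff y.2 (rampSeries p x) -
        coeff y.2 (rampSeries p x) * coeff y.1 (cartanSeries p ξ) =
      ((y.2 : ℂ) + 1) • (2 : ℂ) • c • (p ^ (n + 1) * x (n + 1)) := by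
    intro y hy
    have hy := Finset.HasAntidiagonal.mem_antidiagonal.1 hy
    rw [cartanSeries, rampSeries, coeff_mk, coeff_mk, smul_mul_smul_comm, smul_mul_smul_comm,
      H.mul_pow_mul, H.mul_pow_mul, add_comm y.2, mul_comm (2 : ℂ), ← smul_sub, ← mul_sub, hx, hy,
      mul_smul, mul_smul_comm, ← mul_assoc, ← pow_succ]
  refine (Finset.sum_congr rfl key).trans ?_
  rw [← Finset.sum_smul, sum_antidiagonal_snd, ← Algebra.smul_def, smul_smul, smul_smul, smul_smul,
    smul_smul]
  congr 1
  push_cast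
  ring

/-- The bracket of the first mode `θ 0` with the ramp series of `θ'`. -/
theorem zero_ramp (H : CurrentRelations p θ θ' ξ) :
    C (θ 0) * rampSeries p θ' - rampSeries p θ' * C (θ 0) = pderiv (cartanSeries p ξ) := by
  ext n
  rw [map_sub, coeff_C_mul, coeff_mul_C, coeff_pderiv, rampSeries, cartanSeries, coeff_mk, coeff_mk,
    mul_smul_comm, smul_mul_assoc, ← smul_sub, ← mul_assoc, ← (H.central_pow n (θ 0)).eq, mul_assoc,
    mul_assoc, ← mul_sub, H.θ_θ', mul_smul_comm, ← mul_assoc, ← pow_succ, zero_add]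

/-- Moving `θ 0 + θ' 0 + 2 ξ 0` to the right of the exponential `T` of the `θ'`: both sides satisfy
`Z' = Z q`, with `q` the ramp series of `θ'`. -/
theorem mul_upper (H : CurrentRelations p θ θ' ξ) {T : R⟦X⟧} (h0 : coeff 0 T = 1)
    (hT : pderiv T = T * rampSeries p θ') :
    C (θ 0 + θ' 0 + (2 : ℂ) • ξ 0) * T =
      T * (C (θ 0) + rampSeries p θ' + cartanSeries p ξ) := by
  refine sub_eq_zero.1 (eq_zero_of_pderiv_eq_mul (w := rampSeries p θ') ?_ ?_)
  · rw [coeff_zero_eq_constantCoeff_apply] at h0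
    simp [h0, rampSeries, cartanSeries]
  · have h1 := H.zero_ramp
    have h2 := H.cartan_ramp (x := θ') (c := 1) (by simpa using H.ξ_θ')
    rw [map_one, map_one, one_mul] at h2
    rw [pderiv_sub, pderiv_mul, pderiv_mul, pderiv_C, pderiv_add, pderiv_add, pderiv_C, hT, ← h1,
      ← h2]
    noncomm_ring

/-- The solution `M` of `M' = h M` for the Cartan series `h` commutes with `h`, because it commutes
with all modes `ξ k`. -/
theorem commute_cartan (H : CurrentRelations p θ θ' ξ) {M : R⟦X⟧} (h0 : coeff 0 M = 1)
    (hM : pderiv M = cartanSeries p ξ * M) : Commute (cartanSeries p ξ) M := by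
  have h1 : ∀ k, Commute (C (ξ k)) M := by
    intro k
    have hk : C (ξ k) * cartanSeries p ξ = cartanSeries p ξ * C (ξ k) := by
      ext n
      rw [coeff_C_mul, coeff_mul_C, cartanSeries, coeff_mk]
      exact ((H.central_pow n _).symm.mul_right (H.comm_ξ k n)).smul_right (2 : ℂ)
    refine sub_eq_zero.1 (eq_zero_of_pderiv_eq_mul' (w := cartanSeries p ξ) ?_ ?_)
    · rw [map_sub, coeff_C_mul, coeff_mul_C, h0, mul_one, one_mul, sub_self]
    · rw [pderiv_sub, pderiv_mul, pderiv_mul, pderiv_C, hM, zero_mul, mul_zero, zero_add, add_zero,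
        ← mul_assoc, hk, mul_sub, mul_assoc, mul_assoc]
  refine commute_of_coeff fun i j => ?_
  rw [cartanSeries, coeff_mk]
  refine ((H.central_pow i _).mul_left ?_).smul_left _
  have := congrArg (coeff j) (h1 i).eq
  rwa [coeff_C_mul, coeff_mul_C] at this

/-- Moving `θ 0` to the right of the Cartan factor `M`: both sides satisfy `Z' = Z h`. -/
theorem mul_cartan (H : CurrentRelations p θ θ' ξ) {M : R⟦X⟧} (h0 : coeff 0 M = 1)
    (hM : pderiv M = cartanSeries p ξ * M) : C (θ 0) * M = M * rampSeries p θ := by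
  have hc := (H.commute_cartan h0 hM).eq
  refine sub_eq_zero.1 (eq_zero_of_pderiv_eq_mul (w := cartanSeries p ξ) ?_ ?_)
  · rw [coeff_zero_eq_constantCoeff_apply] at h0
    simp [h0, rampSeries]
  · have h2 := H.cartan_ramp (x := θ) (c := -1) (by simpa using H.ξ_θ)
    rw [map_neg, map_one, map_neg, map_one, neg_one_mul] at h2
    rw [pderiv_sub, pderiv_mul, pderiv_mul, pderiv_C, ← neg_neg (pderiv (rampSeries p θ)), ← h2,
      hM, hc]
    noncomm_ring

/-- The solution of `M' = (2 ξ 0 + p D) M`, whose coefficients are the powers of `2 ξ 0 + p D`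
applied to `1` divided by factorials, has the Cartan series as its logarithmic derivative. -/
theorem pderiv_eq_cartan_mul (H : CurrentRelations p θ θ' ξ) {D : R →ₗ[ℂ] R}
    (hD : ∀ x y, D (x * y) = D x * y + x * D y) (hDp : D p = 0)
    (hDξ : ∀ k : ℕ, D (ξ k) = ((k : ℂ) + 1) • ξ (k + 1)) {M : R⟦X⟧} (h0 : coeff 0 M = 1)
    (hM : pderiv M = C ((2 : ℂ) • ξ 0) * M + C p * coeffMap D M) :
    pderiv M = cartanSeries p ξ * M := by
  obtain ⟨N, hN0, hN⟩ := exists_pderiv_eq_mul (cartanSeries p ξ)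
  have hcN := (H.commute_cartan hN0 hN).eq
  have hD1 : D 1 = 0 := by simpa using hD 1 1
  have hDpow : ∀ k, D (p ^ k) = 0 := by
    intro k
    induction k with
    | zero => rw [pow_zero, hD1]
    | succ k ih => rw [pow_succ, hD, ih, hDp, zero_mul, mul_zero, add_zero]
  -- `g` is the logarithmic derivative of `N` with respect to `D`, and `h = 2 ξ 0 + p g`.
  let g : R⟦X⟧ := X * PowerSeries.mk fun k => (2 : ℂ) • (p ^ k * ξ (k + 1))
  have hg : cartanSeries p ξ = C ((2 : ℂ) • ξ 0) + C p * g := by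
    ext n
    rw [map_add, coeff_C_mul, cartanSeries, coeff_mk]
    rcases n with _ | n
    · simp [g]
    · simp [g, coeff_succ_X_mul, pow_succ', mul_assoc]
  have hDg : coeffMap D (cartanSeries p ξ) = pderiv g := by
    ext n
    rw [coeff_coeffMap, coeff_pderiv, cartanSeries, coeff_mk, coeff_succ_X_mul, coeff_mk, map_smul,
      hD, hDpow, zero_mul, zero_add, hDξ, mul_smul_comm, smul_comm]
  have hgh : g * cartanSeries p ξ = cartanSeries p ξ * g := by
    refine commute_of_coeff fun i j => ?_
    rcases i with _ | i
    · simp [g]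
    · rw [coeff_succ_X_mul, coeff_mk, cartanSeries, coeff_mk]
      exact (((H.central_pow i _).mul_left
        ((H.central_pow j _).symm.mul_right (H.comm_ξ _ _))).smul_left _).smul_right _
  have hDN : coeffMap D N = g * N := by
    refine sub_eq_zero.1 (eq_zero_of_pderiv_eq_mul' (w := cartanSeries p ξ) ?_ ?_)
    · rw [map_sub, coeff_coeffMap, hN0, hD1]
      simp [g]
    · rw [pderiv_sub, pderiv_coeffMap, hN, coeffMap_mul hD, pderiv_mul, hN, hDg, mul_sub,
        ← mul_assoc, ← mul_assoc, hgh]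
      abel
  have hN' : pderiv N = C ((2 : ℂ) • ξ 0) * N + C p * coeffMap D N := by
    rw [hDN, ← mul_assoc, ← add_mul, ← hg, hN]
  have hMN : M = N := by
    ext n
    induction n with
    | zero => rw [h0, hN0]
    | succ n ih =>
      have h1 := congrArg (coeff n) hM
      have h2 := congrArg (coeff n) hN'
      rw [map_add, coeff_C_mul, coeff_C_mul, coeff_coeffMap, coeff_pderiv] at h1 h2
      rw [ih, ← h2] at h1
      exact smul_right_injective R (by exact_mod_cast n.succ_ne_zero : (n : ℂ) + 1 ≠ 0) h1
  rw [hMN, hN]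

/-- The Gauss decomposition of `exp (u (θ 0 + θ' 0 + 2 ξ 0))`: it is the product of the
exponential `T'` of the `θ'`, the Cartan factor `M` and the exponential `T` of the `θ`. -/
theorem gauss_decomposition (H : CurrentRelations p θ θ' ξ) {T T' M : R⟦X⟧}
    (hT0 : coeff 0 T = 1) (hT : pderiv T = rampSeries p θ * T)
    (hT'0 : coeff 0 T' = 1) (hT' : pderiv T' = T' * rampSeries p θ')
    (hM0 : coeff 0 M = 1) (hM : pderiv M = cartanSeries p ξ * M) (n : ℕ) :
    (θ 0 + θ' 0 + (2 : ℂ) • ξ 0) ^ n = (n ! : ℂ) • coeff n (T' * M * T) := by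
  have h1 := H.mul_upper hT'0 hT'
  have h2 := H.mul_cartan hM0 hM
  have h3 : pderiv (T' * M * T) = C (θ 0 + θ' 0 + (2 : ℂ) • ξ 0) * (T' * M * T) := by
    rw [← mul_assoc, ← mul_assoc, h1, pderiv_mul, pderiv_mul, hT, hT', hM, ← mul_assoc (T' * M),
      mul_assoc T' M (rampSeries p θ), ← h2]
    noncomm_ring
  induction n with
  | zero =>
    simp only [coeff_zero_eq_constantCoeff_apply] at hT0 hT'0 hM0
    simp [hT0, hT'0, hM0]
  | succ n ih =>
    have h4 := congrArg (coeff n) h3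
    rw [coeff_pderiv, coeff_C_mul] at h4
    rw [pow_succ', ih, mul_smul_comm, ← h4, smul_smul, Nat.factorial_succ]
    congr 1
    push_cast
    ring

end CurrentRelations

end Series

end

/-! ### Exponentials as sums over partitions -/

section

open PowerSeries

/-- The multisets of parts of the partitions of `a` of length `l`. -/
def partsOf (a l : ℕ) : Finset (Multiset ℕ) :=
  ((Finset.univ : Finset (Nat.Partition a)).filter fun α => Multiset.card α.parts = l).image
    Nat.Partition.parts

theorem mem_partsOf {a l : ℕ} {s : Multiset ℕ} :
    s ∈ partsOf a l ↔ s.sum = a ∧ 0 ∉ s ∧ Multiset.card s = l := by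
  simp only [partsOf, Finset.mem_image, Finset.mem_filter, Finset.mem_univ, true_and]
  constructor
  · rintro ⟨α, hα, rfl⟩
    exact ⟨α.parts_sum, fun h => (α.parts_pos h).ne rfl, hα⟩
  · rintro ⟨h1, h2, h3⟩
    exact ⟨⟨s, fun {i} hi => Nat.pos_of_ne_zero fun h => h2 (h ▸ hi), h1⟩, h3, rfl⟩

/-- The product of the factorials of the multiplicities of a multiset. -/
def multFact (s : Multiset ℕ) : ℕ := ∏ k ∈ s.toFinset, (s.count k)!

theorem multFact_eq_prod {s : Multiset ℕ} {S : Finset ℕ} (h : s.toFinset ⊆ S) :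
    multFact s = ∏ k ∈ S, (s.count k)! :=
  Finset.prod_subset h fun k _ hk => by
    rw [Multiset.count_eq_zero.2 (fun h => hk (Multiset.mem_toFinset.2 h)), Nat.factorial_zero]

theorem multFact_cons (k : ℕ) (s : Multiset ℕ) :
    multFact (k ::ₘ s) = (s.count k + 1) * multFact s := by
  have hS : s.toFinset ⊆ insert k s.toFinset := Finset.subset_insert _ _
  rw [multFact_eq_prod (S := insert k s.toFinset) (by rw [Multiset.toFinset_cons]),
    multFact_eq_prod hS, ← Finset.mul_prod_erase _ _ (Finset.mem_insert_self k _),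
    ← Finset.mul_prod_erase (insert k s.toFinset) (fun j => (s.count j)!)
      (Finset.mem_insert_self k _), Multiset.count_cons_self, Nat.factorial_succ, mul_assoc]
  congr 2
  refine Finset.prod_congr rfl fun j hj => ?_
  rw [Multiset.count_cons_of_ne (Finset.ne_of_mem_erase hj)]

theorem multFact_pos (s : Multiset ℕ) : 0 < multFact s :=
  Finset.prod_pos fun _ _ => Nat.factorial_pos _

section

variable {R : Type*} [Ring R] [Algebra ℂ R]

/-- The product of the `x k` over the elements `k` of a multiset, in decreasing order. -/
def sortProd (x : ℕ → R) (s : Multiset ℕ) : R := ((s.sort (· ≥ ·)).map x).prod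

omit [Algebra ℂ R] in
theorem sortProd_cons {x : ℕ → R} (hx : ∀ i j, Commute (x i) (x j)) (k : ℕ) (s : Multiset ℕ) :
    sortProd x (k ::ₘ s) = x k * sortProd x s := by
  rw [sortProd, sortProd, ← List.prod_cons, ← List.map_cons]
  refine List.Perm.prod_eq' (List.Perm.map _ ?_) ?_
  · rw [← Multiset.coe_eq_coe, ← Multiset.cons_coe, Multiset.sort_eq, Multiset.sort_eq]
  · exact List.pairwise_map.2 (List.pairwise_of_forall fun a b => hx a b)

omit [Algebra ℂ R] in
theorem commute_sortProd {x : ℕ → R} {y : R} (hx : ∀ i, Commute y (x i)) (s : Multiset ℕ) :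
    Commute y (sortProd x s) :=
  Commute.list_prod_right _ _ fun z hz => by
    obtain ⟨i, _, rfl⟩ := List.mem_map.1 hz
    exact hx i

/-- For commuting `x k`, the coefficient of `uᵃ` in `(∑ x_k uᵏ) ^ l / l!`, where `k > 0`, written as
a sum over the partitions of `a` of length `l`. -/
noncomputable def partitionSum (x : ℕ → R) (a l : ℕ) : R :=
  ∑ s ∈ partsOf a l, (1 / (multFact s : ℂ)) • sortProd x s

theorem partitionSum_eq_zero (x : ℕ → R) {a l : ℕ} (h : a < l) : partitionSum x a l = 0 := by
  refine Finset.sum_eq_zero fun s hs => ?_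
  obtain ⟨h1, h2, h3⟩ := mem_partsOf.1 hs
  have h4 := Multiset.card_nsmul_le_sum (s := s) (a := 1) fun i hi =>
    Nat.pos_of_ne_zero fun h => h2 (h ▸ hi)
  rw [h1, h3, smul_eq_mul, mul_one] at h4
  omega

theorem partitionSum_zero_zero (x : ℕ → R) : partitionSum x 0 0 = 1 := by
  have h : partsOf 0 0 = {0} := by
    ext s
    rw [mem_partsOf, Finset.mem_singleton, Multiset.card_eq_zero]
    exact ⟨fun h => h.2.2, fun h => by simp [h]⟩
  rw [partitionSum, h, Finset.sum_singleton]
  simp [multFact, sortProd]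

theorem partitionSum_succ_zero (x : ℕ → R) (a : ℕ) : partitionSum x (a + 1) 0 = 0 := by
  refine Finset.sum_eq_zero fun s hs => ?_
  obtain ⟨h1, h2, h3⟩ := mem_partsOf.1 hs
  rw [Multiset.card_eq_zero.1 h3, Multiset.sum_zero] at h1
  omega

/-- Differentiation of `(∑ x_k uᵏ) ^ (l + 1) / (l + 1)!`: a part is removed from each partition. -/
theorem partitionSum_succ_succ {x : ℕ → R} (hx : ∀ i j, Commute (x i) (x j)) (a l : ℕ) :
    ((a : ℂ) + 1) • partitionSum x (a + 1) (l + 1) =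
      ∑ y ∈ Finset.HasAntidiagonal.antidiagonal a,
        ((y.1 : ℂ) + 1) • (x (y.1 + 1) * partitionSum x y.2 l) := by
  have h1 : ∀ s ∈ partsOf (a + 1) (l + 1), ((a : ℂ) + 1) • (1 / (multFact s : ℂ)) • sortProd x s =
      ∑ k ∈ s.toFinset, ((k : ℂ) * s.count k / multFact s) • sortProd x s := by
    intro s hs
    rw [← Finset.sum_smul, ← Finset.sum_div, smul_smul, mul_one_div]
    congr 2
    have h2 := (Finset.sum_multiset_count s).symm.trans (mem_partsOf.1 hs).1
    simp only [smul_eq_mul, mul_comm (s.count _)] at h2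
    exact_mod_cast h2.symm
  simp only [partitionSum, Finset.smul_sum, Finset.mul_sum]
  rw [Finset.sum_congr rfl h1, Finset.sum_sigma', Finset.sum_sigma']
  refine Finset.sum_bij' (fun z _ => ⟨(z.2 - 1, a + 1 - z.2), z.1.erase z.2⟩)
    (fun z _ => ⟨(z.1.1 + 1) ::ₘ z.2, z.1.1 + 1⟩) ?_ ?_ ?_ ?_ ?_
  · rintro ⟨s, k⟩ hz
    simp only [Finset.mem_sigma, mem_partsOf, Multiset.mem_toFinset,
      Finset.HasAntidiagonal.mem_antidiagonal] at hz ⊢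
    obtain ⟨⟨h1, h2, h3⟩, h4⟩ := hz
    have h5 : k ≠ 0 := fun h => h2 (h ▸ h4)
    have h6 := Multiset.sum_erase h4
    have h7 := Multiset.card_erase_add_one h4
    exact ⟨by omega, by omega, fun h => h2 (Multiset.mem_of_mem_erase h), by omega⟩
  · rintro ⟨⟨k, j⟩, s⟩ hz
    simp only [Finset.mem_sigma, mem_partsOf, Multiset.mem_toFinset,
      Finset.HasAntidiagonal.mem_antidiagonal] at hz ⊢
    obtain ⟨h0, h1, h2, h3⟩ := hz
    refine ⟨⟨by rw [Multiset.sum_cons]; omega, ?_, by rw [Multiset.card_cons, h3]⟩,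
      Multiset.mem_cons_self _ _⟩
    rw [Multiset.mem_cons]
    exact fun h => h.elim (by omega) h2
  · rintro ⟨s, k⟩ hz
    simp only [Finset.mem_sigma, mem_partsOf, Multiset.mem_toFinset] at hz
    obtain ⟨⟨h1, h2, h3⟩, h4⟩ := hz
    have h5 : k - 1 + 1 = k := Nat.succ_pred_eq_of_ne_zero fun h => h2 (h ▸ h4)
    simp only [h5, Multiset.cons_erase h4]
  · rintro ⟨⟨k, j⟩, s⟩ hz
    simp only [Finset.mem_sigma, Finset.HasAntidiagonal.mem_antidiagonal] at hz
    have h5 : a + 1 - (k + 1) = j := by omega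
    simp only [add_tsub_cancel_right, h5, Multiset.erase_cons_head]
  · rintro ⟨s, k⟩ hz
    simp only [Finset.mem_sigma, mem_partsOf, Multiset.mem_toFinset] at hz
    obtain ⟨⟨h1, h2, h3⟩, h4⟩ := hz
    have h5 : k - 1 + 1 = k := Nat.succ_pred_eq_of_ne_zero fun h => h2 (h ▸ h4)
    have h6 : ((k - 1 : ℕ) : ℂ) + 1 = k := by exact_mod_cast h5
    simp only [h5, h6]
    obtain ⟨s, rfl⟩ := Multiset.exists_cons_of_mem h4
    have h7 : (multFact s : ℂ) ≠ 0 := by exact_mod_cast (multFact_pos s).ne'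
    have h8 : ((s.count k : ℂ) + 1) ≠ 0 := by exact_mod_cast (s.count k).succ_ne_zero
    rw [Multiset.erase_cons_head, sortProd_cons hx, multFact_cons, Multiset.count_cons_self,
      mul_smul_comm, smul_smul]
    congr 1
    push_cast
    field_simp

/-- For commuting `x k` and central `p`, the exponential of `∑ pᵏ⁻¹ x_k uᵏ` over `k > 0`. A
partition of `a` of length `l` contributes the power `p ^ (a - l)`; there is none for `l > a`. -/
noncomputable def partitionSeries (p : R) (x : ℕ → R) : R⟦X⟧ :=
  PowerSeries.mk fun a => ∑ l ∈ Finset.range (a + 1), p ^ (a - l) * partitionSum x a l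

theorem coeff_zero_partitionSeries (p : R) (x : ℕ → R) : coeff 0 (partitionSeries p x) = 1 := by
  rw [partitionSeries, coeff_mk, zero_add, Finset.sum_range_one, partitionSum_zero_zero]
  simp

theorem pderiv_partitionSeries {p : R} (hp : ∀ y, Commute p y) {x : ℕ → R}
    (hx : ∀ i j, Commute (x i) (x j)) :
    pderiv (partitionSeries p x) = rampSeries p (fun k => x (k + 1)) * partitionSeries p x := by
  ext a
  rw [coeff_pderiv, coeff_mul, partitionSeries, coeff_mk, Finset.sum_range_succ',
    partitionSum_succ_zero, mul_zero, add_zero, Finset.smul_sum]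
  simp only [Nat.add_sub_add_right, ← mul_smul_comm, partitionSum_succ_succ hx, Finset.mul_sum]
  rw [Finset.sum_comm]
  refine Finset.sum_congr rfl fun y hy => ?_
  have hy := Finset.HasAntidiagonal.mem_antidiagonal.1 hy
  rw [rampSeries, coeff_mk, coeff_mk, Finset.mul_sum]
  symm
  refine Finset.sum_subset_zero_on_sdiff (Finset.range_mono (by omega)) ?_ ?_
  · intro l hl
    simp only [Finset.mem_sdiff, Finset.mem_range, not_lt] at hl
    rw [partitionSum_eq_zero x (by omega), smul_zero, mul_zero, mul_zero]
  · intro l hl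
    have hl := Finset.mem_range.1 hl
    have h1 : a - l = y.1 + (y.2 - l) := by omega
    rw [h1, pow_add, mul_smul_comm, smul_mul_assoc, mul_assoc, mul_assoc, ← mul_assoc (x _),
      ← ((hp (x (y.1 + 1))).pow_left _).eq, mul_assoc,
      mul_smul_comm, mul_smul_comm]

theorem commute_partitionSeries {p : R} (hp : ∀ y, Commute p y) {x : ℕ → R}
    (hx : ∀ i j, Commute (x i) (x j)) :
    Commute (rampSeries p (fun k => x (k + 1))) (partitionSeries p x) := by
  refine commute_of_coeff fun i j => ?_
  rw [rampSeries, partitionSeries, coeff_mk, coeff_mk]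
  refine (((hp _).pow_left i).mul_left ?_).smul_left _
  refine Commute.sum_right _ _ _ fun l _ => ((hp _).pow_left _).symm.mul_right ?_
  exact Commute.sum_right _ _ _ fun s _ => (commute_sortProd (hx _) s).smul_right _

end

end

theorem partSum_eq_partitionSum {n : ℕ} (T : ℤ → LU n) (a l : ℕ) :
    partSum T a l = partitionSum (fun k => T (-(k : ℤ))) a l := by
  rw [partitionSum, partsOf, Finset.sum_image fun α _ β _ h => Nat.Partition.ext h, partSum]
  refine Finset.sum_congr rfl fun α _ => ?_
  have h : partProd T α = sortProd (fun k => T (-(k : ℤ))) α.parts := by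
    -- In `partProd` the list of parts is coerced to a list of integers before it is mapped.
    rw [partProd, sortProd, bind_pure_comp, List.map_eq_map, List.map_map]
    rfl
  rw [h]
  rfl

/-! ### The modes of the orthogonal Lie algebra -/

section

attribute [local instance 100] LieRing.ofAssociativeRing

theorem e_mul_e {n : ℕ} (i j : Idx n) : e i * e j = -(e j * e i) :=
  eq_neg_of_add_eq_zero_left (ExteriorAlgebra.ι_add_mul_swap _ _)

theorem lie_FMat {n : ℕ} (i j k l : Idx n) :
    FMat i (-j) * FMat k (-l) - FMat k (-l) * FMat i (-j) =
      (if k = -j then FMat i (-l) else 0) - (if l = -j then FMat i (-k) else 0) -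
        (if k = -i then FMat j (-l) else 0) + (if l = -i then FMat j (-k) else 0) := by
  have h : ∀ a b c d : Idx n, Matrix.single a (-b) (1 : ℂ) * Matrix.single c d 1 =
      if c = -b then Matrix.single a d 1 else 0 := by
    intro a b c d
    split_ifs with h
    · rw [h, Matrix.single_mul_single_same, one_mul]
    · exact Matrix.single_mul_single_of_ne _ _ _ _ (Ne.symm h) _
  have e : ∀ a b : Idx n, (a = -b) = (b = -a) := fun a b =>
    propext ⟨fun h => by rw [h, neg_neg], fun h => by rw [h, neg_neg]⟩
  simp only [FMat, neg_neg, sub_mul, mul_sub, h]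
  simp only [e i l, e j l, e i k, e j k]
  split_ifs <;> abel

theorem adTau_one (n : ℕ) : adTau n 1 = 0 := by
  have h := derLift_mul (tauDer : LieDerivation ℂ (Hat n) (Hat n)) 1 1
  rw [mul_one, one_mul, mul_one] at h
  exact left_eq_add.1 h

/-- The generator `F_{i,-j}[r]`, which is skew-symmetric in `i` and `j`; it is the entry
`F̃_{i,j}[r]` of the matrix whose Pfaffian is taken. -/
noncomputable def skewMode {n : ℕ} (r : ℤ) (i j : Idx n) : U n := Fmode r i (-j)

theorem skewMode_swap {n : ℕ} (r : ℤ) (i j : Idx n) : skewMode r j i = -skewMode r i j := by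
  have h : F j (-i) = -F i (-j) := by
    apply Subtype.ext
    change FMat j (-i) = -FMat i (-j)
    rw [FMat, FMat, neg_neg, neg_neg, neg_sub]
  rw [skewMode, skewMode, Fmode, Fmode, h, mode_neg, map_neg]

theorem adTau_skewMode {n : ℕ} (r : ℤ) (i j : Idx n) :
    adTau n (skewMode r i j) = (-(r : ℂ)) • skewMode (r - 1) i j := by
  rw [skewMode, skewMode, Fmode, Fmode, adTau, derLift_ι]
  change UniversalEnvelopingAlgebra.ι ℂ (tauLin _) = _
  rw [tauLin_mode, map_smul]

theorem mode_add {n : ℕ} (X Y : so n) (r : ℤ) :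
    (mode (X + Y) r : Hat n) = mode X r + mode Y r := by
  rw [mode, mode, mode, TensorProduct.tmul_add, ← map_add, Prod.mk_add_mk, add_zero]

theorem mode_zero {n : ℕ} (r : ℤ) : (mode (0 : so n) r : Hat n) = 0 := by
  rw [mode, TensorProduct.tmul_zero, Prod.mk_zero_zero, map_zero]

/-- For two modes of non-positive degree the central term of the bracket vanishes. -/
theorem skewMode_comm {n : ℕ} {r s : ℤ} (hr : r ≤ 0) (hs : s ≤ 0) (i j k l : Idx n) :
    skewMode r i j * skewMode s k l - skewMode s k l * skewMode r i j =
      (if k = -j then skewMode (r + s) i l else 0) - (if l = -j then skewMode (r + s) i k else 0) -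
        (if k = -i then skewMode (r + s) j l else 0) +
        (if l = -i then skewMode (r + s) j k else 0) := by
  have h1 : ⁅F i (-j), F k (-l)⁆ =
      (if k = -j then F i (-l) else 0) - (if l = -j then F i (-k) else 0) -
        (if k = -i then F j (-l) else 0) + (if l = -i then F j (-k) else 0) := by
    apply Subtype.ext
    refine (lie_FMat i j k l).trans ?_
    split_ifs <;> rfl
  have h2 : (r : ℂ) * (if r = -s then 1 else 0) = 0 := by
    split_ifs with h
    · have : r = 0 := by omega
      simp [this]
    · exact mul_zero _
  rw [skewMode, skewMode, Fmode, Fmode, ← LieRing.of_associative_ring_bracket, ← LieHom.map_lie,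
    lie_mode, h2, zero_mul, zero_smul, add_zero, h1, sub_eq_add_neg, sub_eq_add_neg, mode_add,
    mode_add, mode_add, mode_neg, mode_neg]
  simp only [apply_ite (fun X : so n => (mode X (r + s) : Hat n)), mode_zero, map_add, map_neg,
    apply_ite (UniversalEnvelopingAlgebra.ι ℂ : Hat n → U n), map_zero, skewMode, Fmode,
    sub_eq_add_neg]

end

/-! ### Commutators of two-forms -/

section PairSum

variable {ι A B : Type*} [DecidableEq ι] [InvolutiveNeg ι] [Ring A] [Algebra ℂ A] [Ring B]
  [Algebra ℂ B] {ε : ι → A}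

omit [DecidableEq ι] [InvolutiveNeg ι] [Algebra ℂ A] in
theorem mul_mul_swap (hε : ∀ i j, ε i * ε j = -(ε j * ε i)) (i j : ι) (x : A) :
    ε i * (ε j * x) = -(ε j * (ε i * x)) := by
  rw [← mul_assoc, hε, neg_mul, mul_assoc]

/-- The element `∑ ε_i ε_j ⊗ G i j` over `i ∈ S` and `j ∈ T`. -/
noncomputable def pairSum (ε : ι → A) (G : ι → ι → B) (S T : Finset ι) : A ⊗[ℂ] B :=
  ∑ i ∈ S, ∑ j ∈ T, (ε i * ε j) ⊗ₜ[ℂ] G i j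

variable (B) in
/-- The sum of `ε_j ε_{-j}` over the `j ∈ S` with `-j ∈ T`. -/
noncomputable def contraction (ε : ι → A) (S T : Finset ι) : A ⊗[ℂ] B :=
  ∑ j ∈ S, ∑ k ∈ T, if k = -j then (ε j * ε k) ⊗ₜ[ℂ] (1 : B) else 0

omit [DecidableEq ι] [InvolutiveNeg ι] in
theorem pairSum_swap (hε : ∀ i j, ε i * ε j = -(ε j * ε i)) {G : ι → ι → B}
    (hG : ∀ i j, G j i = -G i j) (S T : Finset ι) : pairSum ε G S T = pairSum ε G T S := by
  rw [pairSum, Finset.sum_comm]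
  refine Finset.sum_congr rfl fun i _ => Finset.sum_congr rfl fun j _ => ?_
  rw [hε, hG, TensorProduct.tmul_neg, TensorProduct.neg_tmul, neg_neg]

theorem contraction_swap (hε : ∀ i j, ε i * ε j = -(ε j * ε i)) (S T : Finset ι) :
    contraction B ε T S = -contraction B ε S T := by
  rw [contraction, contraction, Finset.sum_comm, ← Finset.sum_neg_distrib]
  refine Finset.sum_congr rfl fun j _ => ?_
  rw [← Finset.sum_neg_distrib]
  refine Finset.sum_congr rfl fun k _ => ?_
  rw [hε, TensorProduct.neg_tmul]
  by_cases h : k = -j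
  · rw [if_pos h, if_pos (by rw [h, neg_neg])]
  · rw [if_neg h, if_neg (fun h' => h (by rw [h', neg_neg])), neg_zero]

theorem contraction_mul_pairSum (G : ι → ι → B) (S T S' T' : Finset ι) :
    contraction B ε T S' * pairSum ε G S T' =
      ∑ j ∈ T, ∑ k ∈ S', ∑ i ∈ S, ∑ l ∈ T',
        (ε j * ε k * (ε i * ε l)) ⊗ₜ[ℂ] (if k = -j then G i l else 0) := by
  rw [contraction, pairSum, Finset.sum_mul]
  refine Finset.sum_congr rfl fun j _ => ?_
  rw [Finset.sum_mul]
  refine Finset.sum_congr rfl fun k _ => ?_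
  rw [Finset.mul_sum]
  refine Finset.sum_congr rfl fun i _ => ?_
  rw [Finset.mul_sum]
  refine Finset.sum_congr rfl fun l _ => ?_
  split_ifs
  · rw [Algebra.TensorProduct.tmul_mul_tmul, one_mul]
  · rw [zero_mul, TensorProduct.tmul_zero]

/-- The commutator of two two-forms whose coefficients satisfy the commutation relations of the
orthogonal Lie algebra: one index of the first is contracted with one of the second. -/
theorem pairSum_comm (hε : ∀ i j, ε i * ε j = -(ε j * ε i)) {G G' G'' : ι → ι → B}
    (hG : ∀ i j k l, G i j * G' k l - G' k l * G i j =
      (if k = -j then G'' i l else 0) - (if l = -j then G'' i k else 0) -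
        (if k = -i then G'' j l else 0) + (if l = -i then G'' j k else 0))
    (S T S' T' : Finset ι) :
    pairSum ε G S T * pairSum ε G' S' T' - pairSum ε G' S' T' * pairSum ε G S T =
      contraction B ε T S' * pairSum ε G'' S T' + contraction B ε T T' * pairSum ε G'' S S' +
        contraction B ε S S' * pairSum ε G'' T T' + contraction B ε S T' * pairSum ε G'' T S' := by
  have hcomm : ∀ i j k l, ε k * ε l * (ε i * ε j) = ε i * ε j * (ε k * ε l) := by
    intro i j k l
    simp only [mul_assoc]
    simp only [mul_mul_swap hε l i, hε l j, mul_neg, neg_neg, mul_mul_swap hε k i,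
      mul_mul_swap hε k j]
  have h1 : pairSum ε G S T * pairSum ε G' S' T' - pairSum ε G' S' T' * pairSum ε G S T =
      ∑ i ∈ S, ∑ j ∈ T, ∑ k ∈ S', ∑ l ∈ T', (ε i * ε j * (ε k * ε l)) ⊗ₜ[ℂ]
        (G i j * G' k l - G' k l * G i j) := by
    have h2 : pairSum ε G' S' T' * pairSum ε G S T =
        ∑ i ∈ S, ∑ j ∈ T, ∑ k ∈ S', ∑ l ∈ T', (ε i * ε j * (ε k * ε l)) ⊗ₜ[ℂ]
          (G' k l * G i j) := by
      simp only [pairSum, Finset.mul_sum]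
      refine Finset.sum_congr rfl fun i _ => Finset.sum_congr rfl fun j _ => ?_
      simp only [Finset.sum_mul]
      refine Finset.sum_congr rfl fun k _ => Finset.sum_congr rfl fun l _ => ?_
      rw [Algebra.TensorProduct.tmul_mul_tmul, hcomm]
    rw [h2]
    simp only [pairSum, Finset.sum_mul]
    simp only [Finset.mul_sum, ← Finset.sum_sub_distrib, TensorProduct.tmul_sub,
      Algebra.TensorProduct.tmul_mul_tmul]
  simp only [h1, hG, sub_eq_add_neg, TensorProduct.tmul_add,
    Finset.sum_add_distrib, contraction_mul_pairSum]
  refine congrArg₂ _ (congrArg₂ _ (congrArg₂ _ ?_ ?_) ?_) ?_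
  · rw [Finset.sum_comm]
    refine Finset.sum_congr rfl fun j _ => ?_
    rw [Finset.sum_comm]
    refine Finset.sum_congr rfl fun k _ => Finset.sum_congr rfl fun i _ =>
      Finset.sum_congr rfl fun l _ => ?_
    simp only [mul_assoc]
    rw [mul_mul_swap hε i j, mul_mul_swap hε i k, mul_neg, neg_neg]
  · rw [Finset.sum_comm]
    refine Finset.sum_congr rfl fun j _ => ?_
    rw [Finset.sum_congr rfl fun i _ => Finset.sum_comm, Finset.sum_comm]
    refine Finset.sum_congr rfl fun l _ => Finset.sum_congr rfl fun i _ =>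
      Finset.sum_congr rfl fun k _ => ?_
    simp only [mul_assoc]
    rw [hε k l, mul_mul_swap hε i j, mul_neg, mul_neg, neg_neg, mul_mul_swap hε i l, mul_neg,
      TensorProduct.tmul_neg, TensorProduct.neg_tmul, neg_neg]
  · refine Finset.sum_congr rfl fun i _ => ?_
    rw [Finset.sum_comm]
    refine Finset.sum_congr rfl fun k _ => Finset.sum_congr rfl fun j _ =>
      Finset.sum_congr rfl fun l _ => ?_
    simp only [mul_assoc]
    rw [mul_mul_swap hε j k, mul_neg, TensorProduct.tmul_neg, TensorProduct.neg_tmul, neg_neg]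
  · refine Finset.sum_congr rfl fun i _ => ?_
    rw [Finset.sum_congr rfl fun j _ => Finset.sum_comm, Finset.sum_comm]
    refine Finset.sum_congr rfl fun l _ => Finset.sum_congr rfl fun j _ =>
      Finset.sum_congr rfl fun k _ => ?_
    simp only [mul_assoc]
    rw [hε k l, mul_neg, mul_mul_swap hε j l, neg_neg]

end PairSum

/-- A derivation of the second factor of a tensor product extends to the tensor product. -/
theorem lTensor_mul {A B : Type*} [Ring A] [Algebra ℂ A] [Ring B] [Algebra ℂ B] {D : B →ₗ[ℂ] B}
    (hD : ∀ x y, D (x * y) = D x * y + x * D y) (x y : A ⊗[ℂ] B) :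
    D.lTensor A (x * y) = D.lTensor A x * y + x * D.lTensor A y := by
  induction x using TensorProduct.induction_on with
  | zero => rw [zero_mul, map_zero, zero_mul, zero_mul, add_zero]
  | add a b ha hb => rw [add_mul, map_add, ha, hb, map_add, add_mul, add_mul]; abel
  | tmul a b =>
    induction y using TensorProduct.induction_on with
    | zero => rw [mul_zero, map_zero, mul_zero, mul_zero, add_zero]
    | add c d hc hd => rw [mul_add, map_add, hc, hd, map_add, mul_add, mul_add]; abel
    | tmul c d =>
      simp only [LinearMap.lTensor_tmul, Algebra.TensorProduct.tmul_mul_tmul, hD,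
        TensorProduct.tmul_add]

/-- If `a` is central in `A`, then `a ⊗ 1` is central in `A ⊗ B`. -/
theorem commute_tmul_one {A B : Type*} [Ring A] [Algebra ℂ A] [Ring B] [Algebra ℂ B] {a : A}
    (ha : ∀ x, Commute a x) (x : A ⊗[ℂ] B) : Commute (a ⊗ₜ[ℂ] (1 : B)) x := by
  induction x using TensorProduct.induction_on with
  | zero => exact Commute.zero_right _
  | tmul c d =>
    change _ * _ = _ * _
    rw [Algebra.TensorProduct.tmul_mul_tmul, Algebra.TensorProduct.tmul_mul_tmul,
      (ha c).eq, one_mul, mul_one]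
  | add c d hc hd => exact hc.add_right hd

theorem commute_e_mul_e {n : ℕ} (i j : Idx n) (x : Lam n) : Commute (e i * e j) x := by
  induction x using ExteriorAlgebra.induction with
  | algebraMap r => exact (Algebra.commutes r _).symm
  | ι v =>
    have h : ∀ k : Idx n, e k * ExteriorAlgebra.ι ℂ v = -(ExteriorAlgebra.ι ℂ v * e k) := fun k =>
      eq_neg_of_add_eq_zero_left (ExteriorAlgebra.ι_add_mul_swap _ _)
    change e i * e j * _ = _ * (e i * e j)
    rw [mul_assoc, h, mul_neg, ← mul_assoc, h, neg_mul, neg_neg, mul_assoc]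
  | mul a b ha hb => exact ha.mul_right hb
  | add a b ha hb => exact ha.add_right hb

/-- The two-form `∑ e_i e_j F_{i,-j}[r]` over `i ∈ A` and `j ∈ B`. -/
noncomputable def pairForm {n : ℕ} (A B : Finset (Idx n)) (r : ℤ) : LU n :=
  pairSum e (skewMode r) A B

theorem pairForm_swap {n : ℕ} (A B : Finset (Idx n)) (r : ℤ) : pairForm A B r = pairForm B A r :=
  pairSum_swap e_mul_e (skewMode_swap r) A B

theorem pairForm_comm {n : ℕ} (A B C D : Finset (Idx n)) {r s : ℤ} (hr : r ≤ 0) (hs : s ≤ 0) :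
    pairForm A B r * pairForm C D s - pairForm C D s * pairForm A B r =
      contraction (U n) e B C * pairForm A D (r + s) +
        contraction (U n) e B D * pairForm A C (r + s) +
        contraction (U n) e A C * pairForm B D (r + s) +
        contraction (U n) e A D * pairForm B C (r + s) :=
  pairSum_comm e_mul_e (skewMode_comm hr hs) A B C D

/-- The action of `ad_τ` on the second factor of `Λ ⊗ U`. -/
noncomputable def adTauForm (n : ℕ) : LU n →ₗ[ℂ] LU n := (adTau n).lTensor (Lam n)

theorem adTauForm_mul {n : ℕ} (x y : LU n) :
    adTauForm n (x * y) = adTauForm n x * y + x * adTauForm n y :=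
  lTensor_mul (derLift_mul _) x y

theorem adTauForm_pairForm {n : ℕ} (A B : Finset (Idx n)) (r : ℤ) :
    adTauForm n (pairForm A B r) = (-(r : ℂ)) • pairForm A B (r - 1) := by
  simp only [pairForm, pairSum, map_sum, adTauForm, LinearMap.lTensor_tmul, adTau_skewMode,
    TensorProduct.tmul_smul, Finset.smul_sum]

/-- The positive indices. -/
noncomputable def posIdx (n : ℕ) : Finset (Idx n) := Finset.univ.filter fun i => 0 < i.1

/-- The negative indices. -/
noncomputable def negIdx (n : ℕ) : Finset (Idx n) := Finset.univ.filter fun i => i.1 < 0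

theorem twoForm_eq_pairForm {n : ℕ} (p q q' : Idx n → Prop) [DecidablePred p] [DecidablePred q]
    [DecidablePred q'] (hq : ∀ j, q' j ↔ q (-j)) (r : ℤ) :
    twoForm n p q r = pairForm (Finset.univ.filter p) (Finset.univ.filter q') r := by
  refine Finset.sum_congr rfl fun i _ => ?_
  refine Finset.sum_bij' (fun j _ => -j) (fun j _ => -j) ?_ ?_ ?_ ?_ ?_
  · intro j hj
    simpa [hq] using hj
  · intro j hj
    simpa [hq] using hj
  · intro j _
    exact neg_neg j
  · intro j _
    exact neg_neg j
  · intro j _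
    rw [skewMode, neg_neg]

theorem Theta_eq (n : ℕ) (r : ℤ) : Theta n r = pairForm (negIdx n) (negIdx n) r :=
  twoForm_eq_pairForm _ _ _ (fun j => by simp) r

theorem ThetaTilde_eq (n : ℕ) (r : ℤ) : ThetaTilde n r = pairForm (posIdx n) (posIdx n) r :=
  twoForm_eq_pairForm _ _ _ (fun j => by simp) r

theorem Xi_eq (n : ℕ) (r : ℤ) : Xi n r = pairForm (negIdx n) (posIdx n) r :=
  twoForm_eq_pairForm _ _ _ (fun j => by simp) r

theorem Omega_eq_pairForm (n : ℕ) (r : ℤ) :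
    Omega n r = pairForm Finset.univ Finset.univ r := by
  have h := twoForm_eq_pairForm (n := n) (fun _ => True) (fun _ => True) (fun _ => True)
    (fun _ => Iff.rfl) r
  rwa [twoForm, Finset.filter_true] at h

theorem sum_univ_eq {n : ℕ} {M : Type*} [AddCommMonoid M] (f : Idx n → M) :
    ∑ i, f i = ∑ i ∈ posIdx n, f i + ∑ i ∈ negIdx n, f i := by
  rw [← Finset.sum_filter_add_sum_filter_not _ (fun i : Idx n => 0 < i.1)]
  refine congrArg₂ _ rfl (Finset.sum_congr (Finset.filter_congr fun i _ => ?_) fun _ _ => rfl)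
  have h := i.2
  simp only [Finset.mem_erase] at h
  omega

theorem Omega_eq (n : ℕ) (r : ℤ) :
    Omega n r = Theta n r + ThetaTilde n r + (2 : ℂ) • Xi n r := by
  have h : Omega n r = pairForm (posIdx n) (posIdx n) r + pairForm (posIdx n) (negIdx n) r +
      (pairForm (negIdx n) (posIdx n) r + pairForm (negIdx n) (negIdx n) r) := by
    simp only [Omega_eq_pairForm, pairForm, pairSum, sum_univ_eq, Finset.sum_add_distrib]
    abel
  rw [h, pairForm_swap (posIdx n) (negIdx n), Theta_eq, ThetaTilde_eq, Xi_eq, two_smul]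
  abel

theorem contraction_pos_neg (n : ℕ) : contraction (U n) e (posIdx n) (negIdx n) = Psi n := by
  refine Finset.sum_congr rfl fun j hj => ?_
  rw [Finset.sum_ite_eq', if_pos]
  simpa [negIdx, posIdx] using hj

theorem contraction_neg_pos (n : ℕ) : contraction (U n) e (negIdx n) (posIdx n) = -Psi n := by
  rw [← contraction_pos_neg, contraction_swap e_mul_e]

theorem contraction_pos_pos (n : ℕ) : contraction (U n) e (posIdx n) (posIdx n) = 0 := by
  refine Finset.sum_eq_zero fun j hj => Finset.sum_eq_zero fun k hk => if_neg ?_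
  rintro rfl
  simp [posIdx] at hj hk
  omega

theorem contraction_neg_neg (n : ℕ) : contraction (U n) e (negIdx n) (negIdx n) = 0 := by
  refine Finset.sum_eq_zero fun j hj => Finset.sum_eq_zero fun k hk => if_neg ?_
  rintro rfl
  simp [negIdx] at hj hk
  omega

theorem commute_Psi {n : ℕ} (x : LU n) : Commute (Psi n) x :=
  Commute.sum_left _ _ _ fun _ _ => commute_tmul_one (commute_e_mul_e _ _) _

theorem adTauForm_Psi (n : ℕ) : adTauForm n (Psi n) = 0 := by
  simp only [Psi, map_sum, adTauForm, LinearMap.lTensor_tmul, adTau_one, TensorProduct.tmul_zero,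
    Finset.sum_const_zero]

/-- The relations of the current algebra of type `𝔰𝔩₂` from the contraction rule, for two-forms
`P a b` indexed by the signs of their two indices (`true` being positive). -/
theorem CurrentRelations.of_contractions {R : Type*} [Ring R] [Algebra ℂ R] {ψ : R}
    {P : Bool → Bool → ℕ → R} {c : Bool → Bool → R} (hψ : ∀ x, Commute ψ x)
    (hP : ∀ a b i, P a b i = P b a i)
    (hpp : c true true = 0) (hnn : c false false = 0) (hpn : c true false = ψ)
    (hnp : c false true = -ψ)
    (h : ∀ a b a' b' i j, P a b i * P a' b' j - P a' b' j * P a b i =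
      c b a' * P a b' (i + j + 1) + c b b' * P a a' (i + j + 1) +
        c a a' * P b b' (i + j + 1) + c a b' * P b a' (i + j + 1)) :
    CurrentRelations ((-2 : ℂ) • ψ) (P false false) (P true true) (P false true) := by
  refine ⟨fun x => (hψ x).smul_left _, fun i j => sub_eq_zero.1 ?_, fun i j => ?_, fun i j => ?_,
    fun i j => ?_⟩ <;> rw [h]
  · rw [hpn, hpp, hnn, hnp, hP true false]
    simp
  · rw [hnp, smul_mul_assoc, neg_mul]
    module
  · rw [hpn, hnn, smul_mul_assoc, zero_mul]
    module
  · rw [hpp, hnp, smul_mul_assoc, neg_mul, zero_mul]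
    module

theorem currentRelations (n : ℕ) :
    CurrentRelations ((-2 : ℂ) • Psi n) (fun k => Theta n (-(k + 1 : ℕ)))
      (fun k => ThetaTilde n (-(k + 1 : ℕ))) (fun k => Xi n (-(k + 1 : ℕ))) := by
  have hneg : ∀ k : ℕ, (-(k + 1 : ℕ) : ℤ) ≤ 0 := fun k => by omega
  have hadd : ∀ i j : ℕ, (-(i + 1 : ℕ) : ℤ) + (-(j + 1 : ℕ) : ℤ) = (-(i + j + 1 + 1 : ℕ) : ℤ) :=
    fun i j => by push_cast; ring
  let sgn : Bool → Finset (Idx n) := fun b => if b then posIdx n else negIdx n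
  have h : CurrentRelations ((-2 : ℂ) • Psi n)
      (fun k => pairForm (negIdx n) (negIdx n) (-(k + 1 : ℕ)))
      (fun k => pairForm (posIdx n) (posIdx n) (-(k + 1 : ℕ)))
      (fun k => pairForm (negIdx n) (posIdx n) (-(k + 1 : ℕ))) :=
    CurrentRelations.of_contractions
      (P := fun a b k => pairForm (sgn a) (sgn b) (-(k + 1 : ℕ)))
      (c := fun a b => contraction (U n) e (sgn a) (sgn b)) commute_Psi
      (fun a b i => pairForm_swap _ _ _) (contraction_pos_pos n) (contraction_neg_neg n)
      (contraction_pos_neg n) (contraction_neg_pos n) (fun a b a' b' i j => by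
        have h1 := pairForm_comm (sgn a) (sgn b) (sgn a') (sgn b') (hneg i) (hneg j)
        rw [hadd] at h1
        exact h1)
  simpa only [← Theta_eq, ← ThetaTilde_eq, ← Xi_eq] using h

/-! ### The filtrations by the numbers of positive and of negative indices -/

section Filtration

variable {ι A B : Type*} [Ring A] [Algebra ℂ A] [Ring B] [Algebra ℂ B]

variable (B) in
/-- The span in `A ⊗ B` of the products of the `ε i` with at least `k` factors whose index
satisfies `p`. -/
def indexFiltration (ε : ι → A) (p : ι → Bool) (k : ℕ) : Submodule ℂ (A ⊗[ℂ] B) :=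
  Submodule.span ℂ {x | ∃ (L : List ι) (u : B), k ≤ L.countP p ∧ x = (L.map ε).prod ⊗ₜ[ℂ] u}

variable {ε : ι → A} {p : ι → Bool}

theorem tmul_mem_indexFiltration {k : ℕ} (L : List ι) (u : B) (h : k ≤ L.countP p) :
    (L.map ε).prod ⊗ₜ[ℂ] u ∈ indexFiltration B ε p k :=
  Submodule.subset_span ⟨L, u, h, rfl⟩

theorem mul_mem_indexFiltration {k l : ℕ} {x y : A ⊗[ℂ] B} (hx : x ∈ indexFiltration B ε p k)
    (hy : y ∈ indexFiltration B ε p l) : x * y ∈ indexFiltration B ε p (k + l) := by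
  have h := Submodule.mul_mem_mul hx hy
  rw [indexFiltration, indexFiltration, Submodule.span_mul_span] at h
  refine Submodule.span_mono ?_ h
  rintro _ ⟨_, ⟨L, u, hL, rfl⟩, _, ⟨L', u', hL', rfl⟩, rfl⟩
  refine ⟨L ++ L', u * u', ?_, ?_⟩
  · rw [List.countP_append]
    omega
  · simp only [List.map_append, List.prod_append, Algebra.TensorProduct.tmul_mul_tmul]

theorem one_mem_indexFiltration : (1 : A ⊗[ℂ] B) ∈ indexFiltration B ε p 0 :=
  tmul_mem_indexFiltration [] 1 (Nat.zero_le _)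

theorem pow_mem_indexFiltration {k : ℕ} {x : A ⊗[ℂ] B} (hx : x ∈ indexFiltration B ε p k)
    (m : ℕ) : x ^ m ∈ indexFiltration B ε p (m * k) := by
  induction m with
  | zero => rw [pow_zero, zero_mul]; exact one_mem_indexFiltration
  | succ m ih => rw [pow_succ, Nat.succ_mul]; exact mul_mem_indexFiltration ih hx

theorem lTensor_mem_indexFiltration (D : B →ₗ[ℂ] B) {k : ℕ} {x : A ⊗[ℂ] B}
    (hx : x ∈ indexFiltration B ε p k) : D.lTensor A x ∈ indexFiltration B ε p k := by
  induction hx using Submodule.span_induction with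
  | mem x h =>
    obtain ⟨L, u, hL, rfl⟩ := h
    exact tmul_mem_indexFiltration L (D u) hL
  | zero => rw [map_zero]; exact Submodule.zero_mem _
  | add x y _ _ hx hy => rw [map_add]; exact Submodule.add_mem _ hx hy
  | smul c x _ hx => rw [map_smul]; exact Submodule.smul_mem _ _ hx

theorem pairSum_mem_indexFiltration (G : ι → ι → B) {S T : Finset ι} {k : ℕ}
    (h : ∀ i ∈ S, ∀ j ∈ T, k ≤ [i, j].countP p) : pairSum ε G S T ∈ indexFiltration B ε p k := by
  refine Submodule.sum_mem _ fun i hi => Submodule.sum_mem _ fun j hj => ?_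
  have := tmul_mem_indexFiltration (ε := ε) [i, j] (G i j) (h i hi j hj)
  simpa using this

theorem contraction_mem_indexFiltration [DecidableEq ι] [InvolutiveNeg ι] {S T : Finset ι} {k : ℕ}
    (h : ∀ i ∈ S, ∀ j ∈ T, k ≤ [i, j].countP p) :
    contraction B ε S T ∈ indexFiltration B ε p k := by
  refine Submodule.sum_mem _ fun i hi => Submodule.sum_mem _ fun j hj => ?_
  have := tmul_mem_indexFiltration (ε := ε) [i, j] (1 : B) (h i hi j hj)
  split_ifs
  · simpa using this
  · exact Submodule.zero_mem _

/-- A product over a list with more elements satisfying `p` than there are has a repeated factor. -/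
theorem indexFiltration_eq_bot [Fintype ι] {k : ℕ}
    (hε : ∀ L : List ι, ¬ L.Nodup → (L.map ε).prod = 0)
    (hk : (Finset.univ.filter fun i => p i = true).card < k) : indexFiltration B ε p k = ⊥ := by
  classical
  rw [indexFiltration, Submodule.span_eq_bot]
  rintro _ ⟨L, u, hL, rfl⟩
  rw [hε L, TensorProduct.zero_tmul]
  intro hn
  have h1 : (L.filter p).toFinset ⊆ Finset.univ.filter fun i => p i = true := by
    intro i hi
    simpa using (List.mem_filter.1 (List.mem_toFinset.1 hi)).2
  have h2 := Finset.card_le_card h1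
  rw [List.toFinset_card_of_nodup (hn.filter _), ← List.countP_eq_length_filter] at h2
  omega

theorem sortProd_mem_indexFiltration {x : ℕ → A ⊗[ℂ] B} {k : ℕ}
    (hx : ∀ i, x i ∈ indexFiltration B ε p k) (s : Multiset ℕ) :
    sortProd x s ∈ indexFiltration B ε p (Multiset.card s * k) := by
  have h : ∀ L : List ℕ, (L.map x).prod ∈ indexFiltration B ε p (L.length * k) := by
    intro L
    induction L with
    | nil => rw [List.length_nil, zero_mul]; exact one_mem_indexFiltration
    | cons a L ih =>
      rw [List.map_cons, List.prod_cons, List.length_cons, Nat.succ_mul, add_comm]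
      exact mul_mem_indexFiltration (hx a) ih
  have := h (s.sort (· ≥ ·))
  rwa [Multiset.length_sort] at this

theorem partitionSum_mem_indexFiltration {x : ℕ → A ⊗[ℂ] B} {k : ℕ}
    (hx : ∀ i, x i ∈ indexFiltration B ε p k) (a l : ℕ) :
    partitionSum x a l ∈ indexFiltration B ε p (l * k) := by
  refine Submodule.sum_mem _ fun s hs => Submodule.smul_mem _ _ ?_
  rw [← (mem_partsOf.1 hs).2.2]
  exact sortProd_mem_indexFiltration hx s

end Filtration

theorem prod_map_e_eq_zero {n : ℕ} (L : List (Idx n)) (h : ¬ L.Nodup) : (L.map e).prod = 0 := by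
  have h1 : (L.map e).prod =
      ExteriorAlgebra.ιMulti ℂ L.length (fun i => Pi.single (L.get i) (1 : ℂ)) := by
    rw [ExteriorAlgebra.ιMulti_apply]
    congr 1
    conv_lhs => rw [← List.ofFn_get L, List.map_ofFn]
    rfl
  rw [h1]
  refine ExteriorAlgebra.ιMulti_eq_zero_of_not_inj fun hi => h ?_
  exact List.nodup_iff_injective_get.2 fun a b hab => hi (by simp only [hab])

theorem card_posIdx_le (n : ℕ) : (posIdx n).card ≤ n := by
  have h := Finset.card_le_card_of_injOn (s := posIdx n) (t := Finset.Icc (1 : ℤ) n) (fun i => i.1)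
    (fun i hi => by
      have h1 := i.2
      simp only [posIdx, Finset.mem_erase, Finset.mem_Icc, Finset.coe_Icc, Finset.coe_filter,
        Set.mem_ofPred_eq, Set.mem_Icc] at hi h1 ⊢
      omega) (fun i _ j _ hij => Subtype.ext hij)
  simpa using h

theorem card_negIdx_le (n : ℕ) : (negIdx n).card ≤ n := by
  refine le_trans ?_ (card_posIdx_le n)
  refine Finset.card_le_card_of_injOn (fun i => -i) (fun i hi => ?_)
    (fun i _ j _ hij => neg_injective hij)
  simpa [negIdx, posIdx] using hi

/-- The part of `Λ ⊗ U` with at least `k` indices of a given sign. -/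
noncomputable def signFiltration (n : ℕ) (pos : Bool) (k : ℕ) : Submodule ℂ (LU n) :=
  indexFiltration (U n) e (fun i : Idx n => decide (0 < i.1) == pos) k

theorem signFiltration_eq_bot {n : ℕ} (pos : Bool) {k : ℕ} (hk : n < k) :
    signFiltration n pos k = ⊥ := by
  refine indexFiltration_eq_bot prod_map_e_eq_zero (lt_of_le_of_lt ?_ hk)
  cases pos
  · refine le_trans (Finset.card_le_card fun i hi => ?_) (card_negIdx_le n)
    have h := i.2
    simp only [Finset.mem_filter, Finset.mem_univ, true_and, beq_iff_eq, decide_eq_false_iff_not,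
      negIdx, Finset.mem_erase] at hi h ⊢
    omega
  · refine le_trans (Finset.card_le_card fun i hi => ?_) (card_posIdx_le n)
    simpa [posIdx] using hi

theorem countP_pos_pos {n : ℕ} {i j : Idx n} (hi : i ∈ posIdx n) (hj : j ∈ posIdx n) (pos : Bool) :
    (if pos then 2 else 0) ≤ [i, j].countP (fun i : Idx n => decide (0 < i.1) == pos) := by
  simp only [posIdx, Finset.mem_filter, Finset.mem_univ, true_and] at hi hj
  cases pos <;> simp [hi, hj]

theorem countP_neg_neg {n : ℕ} {i j : Idx n} (hi : i ∈ negIdx n) (hj : j ∈ negIdx n) (pos : Bool) :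
    (if pos then 0 else 2) ≤ [i, j].countP (fun i : Idx n => decide (0 < i.1) == pos) := by
  simp only [negIdx, Finset.mem_filter, Finset.mem_univ, true_and] at hi hj
  cases pos <;> simp [hi.le, hj.le]

theorem countP_pos_neg {n : ℕ} {i j : Idx n} (hi : i ∈ posIdx n) (hj : j ∈ negIdx n) (pos : Bool) :
    1 ≤ [i, j].countP (fun i : Idx n => decide (0 < i.1) == pos) := by
  simp only [posIdx, negIdx, Finset.mem_filter, Finset.mem_univ, true_and] at hi hj
  cases pos <;> simp [hi, hj.le]

theorem countP_neg_pos {n : ℕ} {i j : Idx n} (hi : i ∈ negIdx n) (hj : j ∈ posIdx n) (pos : Bool) :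
    1 ≤ [i, j].countP (fun i : Idx n => decide (0 < i.1) == pos) := by
  rw [(List.Perm.swap j i []).countP_eq]
  exact countP_pos_neg hj hi pos

theorem ThetaTilde_mem (n : ℕ) (r : ℤ) (pos : Bool) :
    ThetaTilde n r ∈ signFiltration n pos (if pos then 2 else 0) := by
  rw [ThetaTilde_eq]
  exact pairSum_mem_indexFiltration _ fun i hi j hj => countP_pos_pos hi hj pos

theorem Theta_mem (n : ℕ) (r : ℤ) (pos : Bool) :
    Theta n r ∈ signFiltration n pos (if pos then 0 else 2) := by
  rw [Theta_eq]
  exact pairSum_mem_indexFiltration _ fun i hi j hj => countP_neg_neg hi hj pos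

theorem Xi_mem (n : ℕ) (r : ℤ) (pos : Bool) : Xi n r ∈ signFiltration n pos 1 := by
  rw [Xi_eq]
  exact pairSum_mem_indexFiltration _ fun i hi j hj => countP_neg_pos hi hj pos

theorem Psi_mem (n : ℕ) (pos : Bool) : Psi n ∈ signFiltration n pos 1 := by
  rw [← contraction_pos_neg]
  exact contraction_mem_indexFiltration fun i hi j hj => countP_pos_neg hi hj pos

theorem XiPsi_apply {n : ℕ} (x : LU n) :
    XiPsi n x = Xi n (-1) * x - Psi n * adTauForm n x := rfl

theorem XiPsi_pow_mem (n : ℕ) (pos : Bool) (k : ℕ) :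
    (XiPsi n ^ k) 1 ∈ signFiltration n pos k := by
  induction k with
  | zero => exact one_mem_indexFiltration
  | succ k ih =>
    rw [pow_succ', Module.End.mul_apply, XiPsi_apply, add_comm]
    exact Submodule.sub_mem _ (mul_mem_indexFiltration (Xi_mem n _ pos) ih)
      (mul_mem_indexFiltration (Psi_mem n pos) (lTensor_mem_indexFiltration _ ih))

/-- The products of different numbers of `Θ̃`s and `Θ`s have more than `n` indices of the same
sign, so that they vanish. -/
theorem prod_eq_zero_of_length_ne {n a b l l' : ℕ} (hab : a + b ≤ n) (hl : l ≤ a) (hl' : l' ≤ b)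
    (h : l ≠ l') :
    partitionSum (fun k => ThetaTilde n (-(k : ℤ))) a l * (-Psi n) ^ (a - l + (b - l')) *
      (XiPsi n ^ (n - a - b)) 1 * partitionSum (fun k => Theta n (-(k : ℤ))) b l' = 0 := by
  -- The degree is `2 l + (a - l) + (b - l') + (n - a - b) = n + l - l'` for positive indices, and
  -- `n + l' - l` for negative ones.
  have key : ∀ pos : Bool, _ ∈ signFiltration n pos _ := fun pos =>
    mul_mem_indexFiltration (mul_mem_indexFiltration (mul_mem_indexFiltration
      (partitionSum_mem_indexFiltration (fun k => ThetaTilde_mem n (-(k : ℤ)) pos) a l)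
      (pow_mem_indexFiltration (Submodule.neg_mem _ (Psi_mem n pos)) (a - l + (b - l'))))
      (XiPsi_pow_mem n pos (n - a - b)))
      (partitionSum_mem_indexFiltration (fun k => Theta_mem n (-(k : ℤ)) pos) b l')
  rcases lt_or_gt_of_ne h with h | h
  · have h1 := key false
    rw [signFiltration_eq_bot false (by simp; omega)] at h1
    exact (Submodule.mem_bot ℂ).1 h1
  · have h1 := key true
    rw [signFiltration_eq_bot true (by simp; omega)] at h1
    exact (Submodule.mem_bot ℂ).1 h1

/-! ### The Pfaffian -/

/-- A family indexed by `Fin (2 * n)` as a family of pairs. -/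
def pairsEquiv (n : ℕ) (ι : Type*) : (Fin (2 * n) → ι) ≃ (Fin n → ι × ι) where
  toFun g k := (g ⟨2 * k, by omega⟩, g ⟨2 * k + 1, by omega⟩)
  invFun f k := if (k : ℕ) % 2 = 0 then (f ⟨k / 2, by omega⟩).1 else (f ⟨k / 2, by omega⟩).2
  left_inv g := by
    funext k
    by_cases h : (k : ℕ) % 2 = 0
    · simp only [h, if_true]
      exact congrArg g (Fin.ext (by simp only; omega))
    · simp only [h, if_false]
      exact congrArg g (Fin.ext (by simp only; omega))
  right_inv f := by
    funext k
    have h1 : (2 * (k : ℕ) + 1) % 2 = 1 := by omega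
    have h2 : (2 * (k : ℕ) + 1) / 2 = k := by omega
    simp [h1, h2]

section

variable {ι A B : Type*} [Fintype ι] [Ring A] [Algebra ℂ A] [Ring B] [Algebra ℂ B]

theorem sum_pow_eq_sum_prod {R κ : Type*} [Fintype κ] [Ring R] (x : κ → R) (n : ℕ) :
    (∑ i, x i) ^ n = ∑ f : Fin n → κ, (List.ofFn fun k => x (f k)).prod := by
  induction n with
  | zero => simp
  | succ n ih =>
    rw [pow_succ', ih, Finset.sum_mul, ← (Fin.consEquiv fun _ => κ).sum_comp,
      Fintype.sum_prod_type]
    refine Finset.sum_congr rfl fun i _ => ?_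
    rw [Finset.mul_sum]
    refine Finset.sum_congr rfl fun f _ => ?_
    simp [Fin.consEquiv, List.ofFn_succ]

theorem prod_ofFn_tmul {n : ℕ} (a : Fin n → A) (b : Fin n → B) :
    (List.ofFn fun k => a k ⊗ₜ[ℂ] b k).prod = (List.ofFn a).prod ⊗ₜ[ℂ] (List.ofFn b).prod := by
  induction n with
  | zero => rfl
  | succ n ih =>
    rw [List.ofFn_succ, List.ofFn_succ, List.ofFn_succ, List.prod_cons, List.prod_cons,
      List.prod_cons, ih, Algebra.TensorProduct.tmul_mul_tmul]

theorem prod_ofFn_two_mul {M : Type*} [Monoid M] {n : ℕ} (x : Fin (2 * n) → M) :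
    (List.ofFn x).prod =
      (List.ofFn fun k : Fin n => x ⟨2 * k, by omega⟩ * x ⟨2 * k + 1, by omega⟩).prod := by
  rw [List.ofFn_mul', List.prod_flatten, List.map_ofFn]
  refine congrArg List.prod (congrArg List.ofFn (funext fun k => ?_))
  simp [List.ofFn_succ]

theorem pairSum_pow (ε : ι → A) (G : ι → ι → B) (n : ℕ) :
    pairSum ε G Finset.univ Finset.univ ^ n = ∑ g : Fin (2 * n) → ι,
      (List.ofFn fun k => ε (g k)).prod ⊗ₜ[ℂ]
        (List.ofFn fun k : Fin n => G (g ⟨2 * k, by omega⟩) (g ⟨2 * k + 1, by omega⟩)).prod := by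
  have h : pairSum ε G Finset.univ Finset.univ =
      ∑ z : ι × ι, (ε z.1 * ε z.2) ⊗ₜ[ℂ] G z.1 z.2 := by
    rw [Fintype.sum_prod_type, pairSum]
  rw [h, sum_pow_eq_sum_prod, ← (pairsEquiv n ι).sum_comp]
  refine Finset.sum_congr rfl fun g _ => ?_
  rw [prod_ofFn_tmul, prod_ofFn_two_mul]
  rfl

end

theorem enum_bijective (n : ℕ) : Function.Bijective (enum n) := by
  refine (Fintype.bijective_iff_injective_and_card _).2 ⟨fun a b h => ?_, ?_⟩
  · have h1 := congrArg Subtype.val h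
    simp only [enum] at h1
    apply Fin.ext
    split_ifs at h1 <;> omega
  · rw [Fintype.card_fin, Fintype.card_coe, Finset.card_erase_of_mem, Int.card_Icc]
    · omega
    · simp

theorem prod_ofFn_e {n m : ℕ} (g : Fin m → Idx n) :
    (List.ofFn fun k => e (g k)).prod =
      ExteriorAlgebra.ιMulti ℂ m (fun k => Pi.single (g k) (1 : ℂ)) := by
  rw [ExteriorAlgebra.ιMulti_apply]
  rfl

theorem prod_ofFn_e_perm {n : ℕ} (σ : Equiv.Perm (Idx n)) :
    (List.ofFn fun k => e (σ (enum n k))).prod = ((Equiv.Perm.sign σ : ℤ) : ℂ) • topForm n := by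
  let E := Equiv.ofBijective _ (enum_bijective n)
  have h1 := (ExteriorAlgebra.ιMulti ℂ (M := Idx n → ℂ) (2 * n)).map_perm
    (fun k => Pi.single (enum n k) (1 : ℂ)) (E.permCongr.symm σ)
  rw [topForm, prod_ofFn_e, prod_ofFn_e, Int.cast_smul_eq_zsmul]
  have h2 : Equiv.Perm.sign (E.permCongr.symm σ) = Equiv.Perm.sign σ := by
    rw [← Equiv.Perm.sign_permCongr E, Equiv.apply_symm_apply]
  rw [h2] at h1
  refine Eq.trans (congrArg _ (funext fun k => ?_)) h1
  have h3 : enum n (E.permCongr.symm σ k) = σ (enum n k) := by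
    change E (E.symm (σ (E k))) = _
    rw [Equiv.apply_symm_apply]
    rfl
  simp only [Function.comp_apply, h3]

theorem Ftilde_eq (n : ℕ) (r : ℤ) (i j : Idx n) : Ftilde n r i j = skewMode r i j := by
  rw [Ftilde, Matrix.mul_apply, Finset.sum_eq_single (-j)]
  · simp [J, skewMode]
  · intro k _ hk
    have : j ≠ -k := fun h => hk (by rw [h, neg_neg])
    simp [J, this]
  · simp

theorem Omega_pow_eq_sum_perm (n : ℕ) (r : ℤ) :
    Omega n r ^ n = ∑ σ : Equiv.Perm (Idx n), topForm n ⊗ₜ[ℂ] (((Equiv.Perm.sign σ : ℤ) : ℂ) •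
      (List.ofFn fun k : Fin n => Ftilde n r (σ (enum n ⟨2 * k, by omega⟩))
        (σ (enum n ⟨2 * k + 1, by omega⟩))).prod) := by
  rw [Omega_eq_pairForm, pairForm, pairSum_pow]
  symm
  refine Finset.sum_of_injOn (fun σ k => σ (enum n k)) ?_ ?_ ?_ ?_
  · intro σ _ τ _ h
    refine Equiv.ext fun i => ?_
    obtain ⟨k, rfl⟩ := (enum_bijective n).surjective i
    exact congrFun h k
  · intro σ _
    exact Finset.mem_coe.2 (Finset.mem_univ _)
  · intro g _ hg
    rw [prod_ofFn_e, ExteriorAlgebra.ιMulti_eq_zero_of_not_inj, TensorProduct.zero_tmul]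
    intro hi
    have hinj : Function.Injective g := fun a b hab => hi (by simp only [hab])
    have hbij : Function.Bijective g :=
      (Fintype.bijective_iff_injective_and_card _).2
        ⟨hinj, Fintype.card_of_bijective (enum_bijective n)⟩
    refine hg ⟨(Equiv.ofBijective _ (enum_bijective n)).symm.trans (Equiv.ofBijective _ hbij),
      Finset.mem_coe.2 (Finset.mem_univ _), funext fun k => ?_⟩
    change g ((Equiv.ofBijective _ (enum_bijective n)).symm (enum n k)) = g k
    exact congrArg g (Equiv.ofBijective_symm_apply_apply _ (enum_bijective n) k)
  · intro σ _
    rw [prod_ofFn_e_perm, ← TensorProduct.smul_tmul]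
    simp only [Ftilde_eq]

theorem Omega_pow_eq_Pf (n : ℕ) :
    Omega n (-1) ^ n = topForm n ⊗ₜ[ℂ] (((2 : ℂ) ^ n * (n ! : ℂ)) • Pf n) := by
  have h : (2 : ℂ) ^ n * (n ! : ℂ) ≠ 0 :=
    mul_ne_zero (pow_ne_zero _ two_ne_zero) (by exact_mod_cast n.factorial_ne_zero)
  rw [Omega_pow_eq_sum_perm, Pf, smul_smul, mul_one_div, div_self h, one_smul,
    TensorProduct.tmul_sum]

/-! ### Extraction of the coefficients -/

section

open PowerSeries

variable {R : Type*} [Ring R]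

theorem coeff_mul_mul (f g h : R⟦X⟧) (n : ℕ) :
    coeff n (f * g * h) = ∑ ab ∈ Finset.range (n + 1) ×ˢ Finset.range (n + 1) with
      ab.1 + ab.2 ≤ n, coeff ab.1 f * coeff (n - ab.1 - ab.2) g * coeff ab.2 h := by
  simp only [coeff_mul, Finset.sum_mul]
  rw [Finset.sum_sigma']
  refine Finset.sum_bij' (fun z _ => (z.2.1, z.1.2))
    (fun ab _ => ⟨(n - ab.2, ab.2), (ab.1, n - ab.1 - ab.2)⟩) ?_ ?_ ?_ ?_ ?_
  · rintro ⟨⟨s, b⟩, ⟨a, k⟩⟩ hz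
    simp only [Finset.mem_sigma, Finset.HasAntidiagonal.mem_antidiagonal, Finset.mem_filter,
      Finset.mem_product, Finset.mem_range] at hz ⊢
    omega
  · rintro ⟨a, b⟩ hz
    simp only [Finset.mem_sigma, Finset.HasAntidiagonal.mem_antidiagonal, Finset.mem_filter,
      Finset.mem_product, Finset.mem_range] at hz ⊢
    omega
  · rintro ⟨⟨s, b⟩, ⟨a, k⟩⟩ hz
    simp only [Finset.mem_sigma, Finset.HasAntidiagonal.mem_antidiagonal] at hz
    obtain ⟨rfl, rfl⟩ := hz
    have h1 : a + k + b - b = a + k := by omega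
    have h2 : a + k + b - a - b = k := by omega
    simp only [h1, h2]
  · rintro ⟨a, b⟩ _
    rfl
  · rintro ⟨⟨s, b⟩, ⟨a, k⟩⟩ hz
    simp only [Finset.mem_sigma, Finset.HasAntidiagonal.mem_antidiagonal] at hz
    obtain ⟨rfl, rfl⟩ := hz
    have h2 : a + k + b - a - b = k := by omega
    simp only [h2]

variable [Algebra ℂ R]

theorem coeff_partitionSeries (p : R) (x : ℕ → R) {a N : ℕ} (h : a ≤ N) :
    coeff a (partitionSeries p x) =
      ∑ l ∈ Finset.range (N + 1), p ^ (a - l) * partitionSum x a l := by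
  rw [partitionSeries, coeff_mk]
  refine Finset.sum_subset (Finset.range_mono (by omega)) fun l _ hl => ?_
  rw [partitionSum_eq_zero x (by simpa using hl), mul_zero]

/-- The Gauss decomposition in coefficients, when only the terms with equally many `x` and `x'`
survive in degree `n`. -/
theorem pow_eq_sum_partitionSum {ψ : R} {x x' ξ : ℕ → R}
    (H : CurrentRelations ((-2 : ℂ) • ψ) (fun k => x (k + 1)) (fun k => x' (k + 1)) ξ)
    (hx : ∀ i j, Commute (x i) (x j)) (hx' : ∀ i j, Commute (x' i) (x' j))
    {D : R →ₗ[ℂ] R} (hD : ∀ y z, D (y * z) = D y * z + y * D z) (hDψ : D ψ = 0)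
    (hDξ : ∀ k : ℕ, D (ξ k) = ((k : ℂ) + 1) • ξ (k + 1)) {m : ℕ → R} (hm0 : m 0 = 1)
    (hm : ∀ k, m (k + 1) = ξ 0 * m k - ψ * D (m k)) (n : ℕ)
    (hvan : ∀ a b l l', a + b ≤ n → l ≤ a → l' ≤ b → l ≠ l' →
      partitionSum x' a l * (-ψ) ^ (a - l + (b - l')) * m (n - a - b) * partitionSum x b l' = 0) :
    (x 1 + x' 1 + (2 : ℂ) • ξ 0) ^ n =
      ∑ l ∈ Finset.range (n / 2 + 1),
        ∑ ab ∈ Finset.range (n + 1) ×ˢ Finset.range (n + 1) with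
            2 * l ≤ ab.1 + ab.2 ∧ ab.1 + ab.2 ≤ n,
          ((2 : ℂ) ^ (n - 2 * l) * (n ! : ℂ) / ((n - ab.1 - ab.2)! : ℂ)) •
            (partitionSum x' ab.1 l * (-ψ) ^ (ab.1 + ab.2 - 2 * l) * m (n - ab.1 - ab.2) *
              partitionSum x ab.2 l) := by
  have hpow : ∀ k, ((-2 : ℂ) • ψ) ^ k = (2 : ℂ) ^ k • (-ψ) ^ k := by
    intro k
    rw [← smul_pow, smul_neg, neg_smul]
  have hc : ∀ k y, Commute ((-ψ) ^ k) y := by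
    intro k y
    refine (Commute.neg_left ?_).pow_left k
    have h1 := (H.central y).smul_left (-1 / 2 : ℂ)
    rw [smul_smul] at h1
    norm_num at h1
    exact h1
  let M : R⟦X⟧ := PowerSeries.mk fun k => ((2 : ℂ) ^ k / (k ! : ℂ)) • m k
  have hM0 : coeff 0 M = 1 := by
    rw [coeff_mk, hm0, pow_zero, Nat.factorial_zero, Nat.cast_one, div_one, one_smul]
  have hM : pderiv M = cartanSeries ((-2 : ℂ) • ψ) ξ * M := by
    refine H.pderiv_eq_cartan_mul hD (by rw [map_smul, hDψ, smul_zero]) hDξ hM0 ?_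
    ext k
    have hk : (k ! : ℂ) ≠ 0 := by exact_mod_cast k.factorial_ne_zero
    have hk' : (k : ℂ) + 1 ≠ 0 := by exact_mod_cast k.succ_ne_zero
    have hcoef : ((k : ℂ) + 1) * ((2 : ℂ) ^ (k + 1) / ((k + 1)! : ℂ)) =
        2 * ((2 : ℂ) ^ k / (k ! : ℂ)) := by
      rw [Nat.factorial_succ]
      push_cast
      field_simp
      ring
    rw [coeff_pderiv, map_add, coeff_C_mul, coeff_C_mul, coeff_coeffMap, coeff_mk, coeff_mk, hm,
      map_smul, smul_smul, hcoef, smul_mul_assoc, smul_mul_assoc, mul_smul_comm, mul_smul_comm]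
    module
  have hG := H.gauss_decomposition (coeff_zero_partitionSeries _ x)
    (pderiv_partitionSeries H.central hx) (coeff_zero_partitionSeries _ x')
    ((pderiv_partitionSeries H.central hx').trans (commute_partitionSeries H.central hx').eq)
    hM0 hM n
  rw [zero_add] at hG
  -- The summand for the lengths `l` and `l'`.
  let t : ℕ → ℕ × ℕ → R := fun l ab =>
    ((2 : ℂ) ^ (n - 2 * l) * (n ! : ℂ) / ((n - ab.1 - ab.2)! : ℂ)) •
      (partitionSum x' ab.1 l * (-ψ) ^ (ab.1 + ab.2 - 2 * l) * m (n - ab.1 - ab.2) *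
        partitionSum x ab.2 l)
  have ht : ∀ l (ab : ℕ × ℕ), ab.1 + ab.2 < 2 * l → t l ab = 0 := by
    intro l ab h
    rcases lt_or_ge ab.1 l with h1 | h1
    · simp only [t, partitionSum_eq_zero x' h1, zero_mul, smul_zero]
    · simp only [t, partitionSum_eq_zero x (show ab.2 < l by omega), mul_zero, smul_zero]
  have hprod : ∀ a b l l', l ≤ a → l' ≤ b → a + b ≤ n →
      (((-2 : ℂ) • ψ) ^ (a - l) * partitionSum x' a l) * coeff (n - a - b) M *
        (((-2 : ℂ) • ψ) ^ (b - l') * partitionSum x b l') =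
      ((2 : ℂ) ^ (n - l - l') / ((n - a - b)! : ℂ)) •
        (partitionSum x' a l * (-ψ) ^ (a - l + (b - l')) * m (n - a - b) *
          partitionSum x b l') := by
    intro a b l l' hl hl' hab
    have h2 : n - l - l' = a - l + (n - a - b) + (b - l') := by omega
    rw [coeff_mk, hpow, hpow]
    simp only [smul_mul_assoc, mul_smul_comm, smul_smul]
    rw [(hc (a - l) _).eq, h2]
    refine congrArg₂ _ (by ring) ?_
    simp only [pow_add, mul_assoc]
    rw [← mul_assoc (m _), ← (hc (b - l') (m _)).eq, mul_assoc]
  have hterm : ∀ ab : ℕ × ℕ, ab.1 + ab.2 ≤ n →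
      (n ! : ℂ) • (coeff ab.1 (partitionSeries ((-2 : ℂ) • ψ) x') * coeff (n - ab.1 - ab.2) M *
        coeff ab.2 (partitionSeries ((-2 : ℂ) • ψ) x)) = ∑ l ∈ Finset.range (n + 1), t l ab := by
    rintro ⟨a, b⟩ hab
    simp only at hab
    rw [coeff_partitionSeries _ x' (show a ≤ n by omega),
      coeff_partitionSeries _ x (show b ≤ n by omega), Finset.sum_mul, Finset.sum_mul,
      Finset.smul_sum]
    refine Finset.sum_congr rfl fun l hl => ?_
    rw [Finset.mul_sum, Finset.smul_sum, Finset.sum_eq_single l]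
    · rcases lt_or_ge a l with h1 | h1
      · simp only [t, partitionSum_eq_zero x' h1, zero_mul, mul_zero, smul_zero]
      rcases lt_or_ge b l with h2 | h2
      · simp only [t, partitionSum_eq_zero x h2, mul_zero, smul_zero]
      have h3 : a - l + (b - l) = a + b - 2 * l := by omega
      have h4 : n - l - l = n - 2 * l := by omega
      rw [hprod a b l l h1 h2 hab, smul_smul, h3, h4, mul_div_assoc', mul_comm (n ! : ℂ)]
    · intro l' _ hne
      rcases lt_or_ge a l with h1 | h1
      · simp only [partitionSum_eq_zero x' h1, zero_mul, mul_zero, smul_zero]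
      rcases lt_or_ge b l' with h2 | h2
      · simp only [partitionSum_eq_zero x h2, mul_zero, smul_zero]
      rw [hprod a b l l' h1 h2 hab, hvan a b l l' hab h1 h2 hne.symm, smul_zero, smul_zero]
    · exact fun h => absurd hl h
  rw [hG, coeff_mul_mul, Finset.smul_sum, Finset.sum_congr rfl fun ab hab =>
    hterm ab (Finset.mem_filter.1 hab).2, Finset.sum_comm]
  symm
  refine Finset.sum_subset_zero_on_sdiff (Finset.range_mono (by omega)) ?_ ?_
  · intro l hl
    simp only [Finset.mem_sdiff, Finset.mem_range] at hl
    exact Finset.sum_eq_zero fun ab hab => ht l ab (by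
      have := (Finset.mem_filter.1 hab).2
      omega)
  · intro l _
    refine Finset.sum_subset_zero_on_sdiff ?_ ?_ fun _ _ => rfl
    · intro ab hab
      simp only [Finset.mem_filter] at hab ⊢
      exact ⟨hab.1, hab.2.2⟩
    · intro ab hab
      simp only [Finset.mem_sdiff, Finset.mem_filter] at hab
      exact ht l ab (by
        by_contra h
        exact hab.2 ⟨hab.1.1, by omega, hab.1.2⟩)

end

theorem commute_Theta {n : ℕ} (i j : ℕ) : Commute (Theta n (-(i : ℤ))) (Theta n (-(j : ℤ))) := by
  have h := pairForm_comm (negIdx n) (negIdx n) (negIdx n) (negIdx n) (r := -(i : ℤ))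
    (s := -(j : ℤ)) (by omega) (by omega)
  rw [Theta_eq, Theta_eq]
  refine sub_eq_zero.1 (h.trans ?_)
  rw [contraction_neg_neg]
  simp only [zero_mul, add_zero]

theorem commute_ThetaTilde {n : ℕ} (i j : ℕ) :
    Commute (ThetaTilde n (-(i : ℤ))) (ThetaTilde n (-(j : ℤ))) := by
  have h := pairForm_comm (posIdx n) (posIdx n) (posIdx n) (posIdx n) (r := -(i : ℤ))
    (s := -(j : ℤ)) (by omega) (by omega)
  rw [ThetaTilde_eq, ThetaTilde_eq]
  refine sub_eq_zero.1 (h.trans ?_)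
  rw [contraction_pos_pos]
  simp only [zero_mul, add_zero]

theorem adTauForm_Xi (n k : ℕ) :
    adTauForm n (Xi n (-(k + 1 : ℕ))) = ((k : ℂ) + 1) • Xi n (-(k + 1 + 1 : ℕ)) := by
  have h : (-(k + 1 : ℕ) : ℤ) - 1 = (-(k + 1 + 1 : ℕ) : ℤ) := by push_cast; ring
  rw [Xi_eq, Xi_eq, adTauForm_pairForm, h]
  congr 1
  push_cast
  ring

theorem Omega_pow_eq_sum (n : ℕ) :
    Omega n (-1) ^ n =
      ∑ l ∈ Finset.range (n / 2 + 1),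
        ∑ ab ∈ Finset.range (n + 1) ×ˢ Finset.range (n + 1) with
            2 * l ≤ ab.1 + ab.2 ∧ ab.1 + ab.2 ≤ n,
          ((2 : ℂ) ^ (n - 2 * l) * (n ! : ℂ) / ((n - ab.1 - ab.2)! : ℂ)) •
            (partSum (ThetaTilde n) ab.1 l * (-Psi n) ^ (ab.1 + ab.2 - 2 * l) *
              ((XiPsi n) ^ (n - ab.1 - ab.2)) 1 * partSum (Theta n) ab.2 l) := by
  simp only [partSum_eq_partitionSum]
  rw [Omega_eq]
  exact pow_eq_sum_partitionSum (x := fun k => Theta n (-(k : ℤ)))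
    (x' := fun k => ThetaTilde n (-(k : ℤ))) (ξ := fun k => Xi n (-(k + 1 : ℕ)))
    (m := fun k => (XiPsi n ^ k) 1) (currentRelations n) commute_Theta commute_ThetaTilde
    adTauForm_mul (adTauForm_Psi n) (adTauForm_Xi n) rfl
    (fun k => by rw [pow_succ', Module.End.mul_apply, XiPsi_apply]; rfl) n
    (fun a b l l' hab hl hl' h => prod_eq_zero_of_length_ne hab hl hl' h)

end AffineOrthogonal

theorem theorem1 (n : ℕ) :
    Omega n (-1) ^ n =
        ∑ l ∈ Finset.range (n / 2 + 1),
          ∑ ab ∈ Finset.range (n + 1) ×ˢ Finset.range (n + 1) with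
              2 * l ≤ ab.1 + ab.2 ∧ ab.1 + ab.2 ≤ n,
            ((2 : ℂ) ^ (n - 2 * l) * (n ! : ℂ) / ((n - ab.1 - ab.2)! : ℂ)) •
              (partSum (ThetaTilde n) ab.1 l * (-Psi n) ^ (ab.1 + ab.2 - 2 * l) *
                ((XiPsi n) ^ (n - ab.1 - ab.2)) 1 * partSum (Theta n) ab.2 l) ∧
      Omega n (-1) ^ n = topForm n ⊗ₜ[ℂ] (((2 : ℂ) ^ n * (n ! : ℂ)) • Pf n) :=
  ⟨Omega_pow_eq_sum n, Omega_pow_eq_Pf n⟩
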